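/- **Proposition 1.** *Model.* Consider $S$ base stations (BSs) at positions $\mathbf q_1,\dots,\mathbf q_S\in\mathbb R^2$, each with a uniform linear array of $N$ antennas with steering vector $\mathbf a(\theta)=[1,e^{-j\pi\sin\theta},\dots,e^{-j(N-1)\pi\sin\theta}]^T$; $K$ communication users; and a point target at $\mathbf p=[p_1,p_2]^T\in\mathbb R^2$, different from all $\mathbf q_{s'}$. Let BS $s$ be the receiving BS, and let all BSs $s'\neq s$ transmit $$\mathbf x_{s'}(t)=\sum_{k=1}^K a_{s',k}\mathbf w_{s',k}\,s_{s',k}(t)+\mathbf s_{s',0}(t),\qquad a_{s',k}\in\{0,1\},\ \mathbf w_{s',k}\in\mathbb C^N .$$ The signals $s_{s',k}$, $\mathbf s_{s',0}$ (random or deterministic functions of time, measured in slots) are known to the receiver, and their distribution does not depend on the unknowns. Let $\theta_{s'}(\mathbf p)$ be the angle of the target seen from BS $s'$ relative to the boresight of its array, $\tau_{s,s'}(\mathbf p)=(\|\mathbf p-\mathbf q_{s'}\|+\|\mathbf p-\mathbf q_s\|)/c$ the delay in slots ($c>0$), $\mathbf G_{s,s'}=\mathbf a(\theta_s)\mathbf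 a(\theta_{s'})^H$, and $\mathbf X_{s,s'}=[\mathbf x_{s'}(1-\tau_{s,s'}),\dots,\mathbf x_{s'}(L-\tau_{s,s'})]$. Given the transmitted signals, the vectorized echo is $$\tilde{\mathbf y}=\sum_{s'\ne s}\alpha_{s,s'}\,\mathrm{vec}(\mathbf G_{s,s'}\mathbf X_{s,s'})+\tilde{\mathbf z},\qquad \tilde{\mathbf z}\sim\mathcal{CN}(\mathbf 0,\sigma^2\mathbf I_{NL}),\ \sigma>0 .$$ The unknowns are $\boldsymbol\xi=[\mathbf p^T,\boldsymbol\alpha^T]^T$, where $\boldsymbol\alpha\in\mathbb R^{2(S-1)}$ lists the real parts and then the imaginary parts of the $\alpha_{s,s'}$, $s'\neq s$. Assume that at the instants $l-\tau_{s,s'}(\mathbf p)$, $1\le l\le L$, the signals are almost surely differentiable, with values and time derivatives of finite second moment. Let $$\mathbf F=\begin{bmatrix}\mathbf F_{\mathbf p\mathbf p}&\mathbf F_{\mathbf p\boldsymbol\alpha}\\ \mathbf F_{\mathbf p\boldsymbol\alpha}^T&\mathbf F_{\boldsymbol\alpha\boldsymbol\alpha}\end{bmatrix}$$ be the Fisher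 information matrix for $\boldsymbol\xi$ of the observation consisting of the transmitted signals and the echo, i.e. the matrix of second moments of the score (which is square integrable). Let $\mathrm{CRLB}^{(s)}(\mathbf p)$ be the trace of the $\mathbf p$-block of $\mathbf F^{-1}$. (a) If $\mathbf F$ is invertible, then so are $\mathbf F_{\boldsymbol\alpha\boldsymbol\alpha}$ and $\mathbf F_{\mathbf p\mathbf p}-\mathbf F_{\mathbf p\boldsymbol\alpha}\mathbf F_{\boldsymbol\alpha\boldsymbol\alpha}^{-1}\mathbf F_{\mathbf p\boldsymbol\alpha}^T$, and $$\mathrm{CRLB}^{(s)}(\mathbf p)=\mathrm{tr}\Big(\big(\mathbf F_{\mathbf p\mathbf p}-\mathbf F_{\mathbf p\boldsymbol\alpha}\mathbf F_{\boldsymbol\alpha\boldsymbol\alpha}^{-1}\mathbf F_{\mathbf p\boldsymbol\alpha}^T\big)^{-1}\Big).$$ Every estimator $\hat{\mathbf p}$ of the position that, given the transmitted signals, is unbiased for all parameters near $\boldsymbol\xi$ satisfies $\mathbb E\|\hat{\mathbf p}-\mathbf p\|^2\ge \mathrm{CRLB}^{(s)}(\mathbf p)$. (b) Write $\dot{(\cdot)}^{(i)}=\partial/\partial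 p_i$, and let $\mathbf R_{s'}=\frac1L\sum_{l=1}^L\mathbb E\,\mathbf s_{s',0}(l)\mathbf s_{s',0}(l)^H$. Suppose that the delayed signals obey the convention $\dot{\mathbf X}^{(i)}_{s,s'}=-\dot\tau^{(i)}_{s,s'}\mathbf X_{s,s'}$. Suppose also that at the instants $l-\tau_{s,s'}(\mathbf p)$, on average over the $L$ slots and the randomness, the communication signals have unit power and are mutually uncorrelated, they are uncorrelated with the sensing signals, the sensing signals of different BSs are uncorrelated, and $\mathbf s_{s',0}$ has covariance $\mathbf R_{s'}$. With $\mathbf Q_{s'}=\sum_k a_{s',k}\mathbf w_{s',k}\mathbf w_{s',k}^H+\mathbf R_{s'}$ and $$\tilde{\mathbf G}^{(i)}_{s,s'}=\dot{\mathbf a}^{(i)}(\theta_s)\mathbf a(\theta_{s'})^H+\mathbf a(\theta_s)\dot{\mathbf a}^{(i)}(\theta_{s'})^H-\dot\tau^{(i)}_{s,s'}\mathbf G_{s,s'},$$ the blocks of $\mathbf F$ are $$[\mathbf F_{\mathbf p\mathbf p}]_{ij}=\tfrac{2L}{\sigma^2}\Re\,\mathrm{tr}\Big(\sum_{s'\ne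 s}|\alpha_{s,s'}|^2\tilde{\mathbf G}^{(j)}_{s,s'}\mathbf Q_{s'}[\tilde{\mathbf G}^{(i)}_{s,s'}]^H\Big),\quad \mathbf F_{\mathbf p\boldsymbol\alpha}=\tfrac{2L}{\sigma^2}\Re\{[1,j]\otimes\mathbf D\},\quad \mathbf F_{\boldsymbol\alpha\boldsymbol\alpha}=\tfrac{2L}{\sigma^2}\mathbf I_2\otimes\mathbf E,$$ where $\mathbf D\in\mathbb C^{2\times(S-1)}$ has entries $\mathbf D_{i,s'}=\alpha_{s,s'}^*\mathrm{tr}(\mathbf G_{s,s'}\mathbf Q_{s'}[\tilde{\mathbf G}^{(i)}_{s,s'}]^H)$, and $\mathbf E$ is diagonal with entries $\mathrm{tr}(\mathbf G_{s,s'}\mathbf Q_{s'}\mathbf G_{s,s'}^H)$, $s'\neq s$. If $\mathbf F$ is invertible, the formula in (a) thus holds with these blocks. -/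

import Mathlib

open MeasureTheory Matrix
open scoped Topology

/-- Points of the plane. -/
abbrev Plane : Type := EuclideanSpace ℝ (Fin 2)

/-- The `i`-th partial derivative of a function on the plane. -/
noncomputable def partialDeriv {E : Type*} [NormedAddCommGroup E] [NormedSpace ℝ E]
    (f : Plane → E) (p : Plane) (i : Fin 2) : E :=
  lineDeriv ℝ f p (EuclideanSpace.single i (1 : ℝ))

/-- Steering vector of a uniform linear array with `N` antennas (half-wavelength spacing):
`a(θ) = [1, e^{-jπ sin θ}, …, e^{-j(N-1)π sin θ}]ᵀ`. -/
noncomputable def steering (N : ℕ) (θ : ℝ) : Fin N → ℂ :=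
  fun n => Complex.exp (-Complex.I * (n : ℂ) * (Real.pi : ℂ) * (Real.sin θ : ℂ))

/-- A network of `S` base stations with `N` antennas each, `K` communication users and a
sensing interval of `L` time slots. The transmitted waveforms are functions of (real) time, in
units of time slots, and of the random outcome `ω : Ω`; nonrandom waveforms are those that do
not depend on `ω`. -/
structure IsacNetwork (S K N L : ℕ) (Ω : Type*) where
  /-- positions of the base stations -/
  pos : Fin S → Plane
  /-- boresight directions of the arrays, as angles from the first coordinate axis -/
  boresight : Fin S → ℝ
  /-- propagation speed, in units of length per time slot -/
  speed : ℝ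
  speed_pos : 0 < speed
  /-- standard deviations of the receiver noise -/
  noise : Fin S → ℝ
  noise_pos : ∀ s, 0 < noise s
  /-- `assoc s k`: user `k` is served by base station `s` -/
  assoc : Fin S → Fin K → Bool
  /-- beamforming vectors -/
  beam : Fin S → Fin K → Fin N → ℂ
  /-- communication signals -/
  sym : Fin S → Fin K → ℝ → Ω → ℂ
  /-- dedicated sensing signals -/
  sens : Fin S → ℝ → Ω → Fin N → ℂ

namespace IsacNetwork

variable {S K N L : ℕ} {Ω : Type*} (M : IsacNetwork S K N L Ω)

/-- The transmitting base stations when `s` is the receiving one. -/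
abbrev Tx (s : Fin S) : Type := {s' : Fin S // s' ≠ s}

/-- Index set of the real unknowns `[p₁, p₂, Re α, Im α]`. -/
abbrev Idx (s : Fin S) : Type := Fin 2 ⊕ (Tx s ⊕ Tx s)

/-- The real parameter vectors. -/
abbrev Param (s : Fin S) : Type := Idx s → ℝ

/-- Target position encoded in a parameter vector. -/
def target {s : Fin S} (ξ : Param s) : Plane := WithLp.toLp 2 fun i => ξ (Sum.inl i)

/-- Complex gain of the link from `s'` via the target to `s`. -/
noncomputable def gain {s : Fin S} (ξ : Param s) (s' : Tx s) : ℂ :=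
  ⟨ξ (Sum.inr (Sum.inl s')), ξ (Sum.inr (Sum.inr s'))⟩

/-- The vectorized observations. -/
abbrev Obs (N L : ℕ) : Type := Fin L × Fin N → ℂ

/-! ### Geometry -/

/-- Angle of the target at `p` seen from base station `s`, relative to the boresight. -/
noncomputable def angle (s : Fin S) (p : Plane) : ℝ :=
  Complex.arg ((⟨p 0 - M.pos s 0, p 1 - M.pos s 1⟩ : ℂ) *
    Complex.exp (-Complex.I * (M.boresight s : ℂ)))

/-- Delay (in time slots) from `s'` to the target at `p` and on to `s`. -/
noncomputable def delay (s s' : Fin S) (p : Plane) : ℝ :=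
  (‖p - M.pos s'‖ + ‖p - M.pos s‖) / M.speed

/-- The sampling instant `l - τ_{s,s'}(p)`, `l = 1, …, L`. -/
noncomputable def instant (s s' : Fin S) (p : Plane) (l : Fin L) : ℝ :=
  ((l : ℝ) + 1) - M.delay s s' p

/-- Target response matrix `G_{s,s'} = a(θ_{r,s}) a(θ_{t,s'})ᴴ`. -/
noncomputable def response (s s' : Fin S) (p : Plane) : Matrix (Fin N) (Fin N) ℂ :=
  vecMulVec (steering N (M.angle s p)) (star (steering N (M.angle s' p)))

/-! ### Transmitted signals -/

/-- Base station selection variable `b_{s'}` when `s` is the receiving base station. -/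
def select (s s' : Fin S) : ℂ := if s' = s then 0 else 1

/-- Waveform `x_{s'}(t)` transmitted by `s'` when `s` is the receiving base station. -/
noncomputable def transmit (s s' : Fin S) (ω : Ω) (t : ℝ) : Fin N → ℂ :=
  (∑ k, ((if M.assoc s' k then 1 else 0 : ℂ) * M.sym s' k t ω) • M.beam s' k) +
    select s s' • M.sens s' t ω

/-- `X_{s,s'} = [x_{s'}[1 - τ_{s,s'}], …, x_{s'}[L - τ_{s,s'}]]`. -/
noncomputable def delayed (s s' : Fin S) (ω : Ω) (p : Plane) : Matrix (Fin N) (Fin L) ℂ :=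
  Matrix.of fun n l => M.transmit s s' ω (M.instant s s' p l) n

/-! ### The stacked Gaussian echo model -/

/-- Noise-free vectorized echo `∑_{s' ≠ s} α_{s,s'} vec(G_{s,s'} X_{s,s'})`. -/
noncomputable def meanEcho (s : Fin S) (ξ : Param s) (ω : Ω) : Obs N L :=
  ∑ s' : Tx s, gain ξ s' • Matrix.vec (M.response s s' (target ξ) * M.delayed s s' ω (target ξ))

/-- Density of the echo given the transmitted signals: circularly symmetric complex Gaussian
with mean `meanEcho` and covariance `σ² I_{NL}`. -/
noncomputable def density (s : Fin S) (ξ : Param s) (ω : Ω) (y : Obs N L) : ℝ :=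
  ((Real.pi * M.noise s ^ 2) ^ (N * L))⁻¹ *
    Real.exp (-(∑ m, ‖y m - M.meanEcho s ξ ω m‖ ^ 2) / M.noise s ^ 2)

/-- Law of the echo given the transmitted signals. -/
noncomputable def condLaw (s : Fin S) (ξ : Param s) (ω : Ω) : Measure (Obs N L) :=
  volume.withDensity fun y => ENNReal.ofReal (M.density s ξ ω y)

/-- Log-likelihood of the observation `(ω, y)`: the transmitted signals are known to the
receiver and their distribution does not depend on the unknown parameters. -/
noncomputable def logLik (s : Fin S) (z : Ω × Obs N L) (ξ : Param s) : ℝ :=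
  Real.log (M.density s ξ z.1 z.2)

/-- Score: partial derivative of the log-likelihood in the `i`-th unknown. -/
noncomputable def score (s : Fin S) (ξ : Param s) (i : Idx s) (z : Ω × Obs N L) : ℝ :=
  lineDeriv ℝ (M.logLik s z) ξ (Pi.single i (1 : ℝ))

variable [MeasurableSpace Ω] (P : Measure Ω)

/-- Joint law of the (known) transmitted signals and the echo. -/
noncomputable def law (s : Fin S) (ξ : Param s) : Measure (Ω × Obs N L) :=
  (P.prod volume).withDensity fun z => ENNReal.ofReal (M.density s ξ z.1 z.2)

/-- Fisher information matrix. -/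
noncomputable def fisher (s : Fin S) (ξ : Param s) : Matrix (Idx s) (Idx s) ℝ :=
  Matrix.of fun i j => ∫ z, M.score s ξ i z * M.score s ξ j z ∂(M.law P s ξ)

/-- Cramér–Rao lower bound for the position: trace of the position block of the inverse Fisher
information matrix of all the unknowns. -/
noncomputable def crlb (s : Fin S) (ξ : Param s) : ℝ :=
  ((M.fisher P s ξ)⁻¹.toBlocks₁₁).trace

/-- `T` is an estimator of the target position which, given the transmitted signals, is
unbiased near the parameter vector `ξ`. -/
def IsUnbiased (s : Fin S) (ξ : Param s) (T : Ω × Obs N L → Plane) : Prop :=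
  Measurable T ∧ ∀ᵐ ω ∂P, ∀ᶠ η in 𝓝 ξ,
    Integrable (fun y => T (ω, y)) (M.condLaw s η ω) ∧
      ∫ y, T (ω, y) ∂(M.condLaw s η ω) = target η

/-- At the sampling instants the signals are almost surely differentiable in time, and their
values and time derivatives have finite second moments. -/
structure RegularSignals (s : Fin S) (p : Plane) : Prop where
  sym_diff : ∀ (s' : Tx s) (k : Fin K) (l : Fin L), ∀ᵐ ω ∂P,
    DifferentiableAt ℝ (fun t => M.sym s' k t ω) (M.instant s s' p l)
  sens_diff : ∀ (s' : Tx s) (n : Fin N) (l : Fin L), ∀ᵐ ω ∂P,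
    DifferentiableAt ℝ (fun t => M.sens s' t ω n) (M.instant s s' p l)
  sym_memLp : ∀ (s' : Tx s) (k : Fin K) (l : Fin L),
    MemLp (fun ω => M.sym s' k (M.instant s s' p l) ω) 2 P
  sens_memLp : ∀ (s' : Tx s) (n : Fin N) (l : Fin L),
    MemLp (fun ω => M.sens s' (M.instant s s' p l) ω n) 2 P
  sym_deriv_memLp : ∀ (s' : Tx s) (k : Fin K) (l : Fin L),
    MemLp (fun ω => deriv (fun t => M.sym s' k t ω) (M.instant s s' p l)) 2 P
  sens_deriv_memLp : ∀ (s' : Tx s) (n : Fin N) (l : Fin L),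
    MemLp (fun ω => deriv (fun t => M.sens s' t ω n) (M.instant s s' p l)) 2 P

/-! ### Second-order statistics and the explicit blocks -/

/-- Covariance of the sensing signal of `s'`: the (mean) sample covariance
`(1/L) ∑_l s_{s',0}[l] s_{s',0}[l]ᴴ`. -/
noncomputable def sensCov (s' : Fin S) : Matrix (Fin N) (Fin N) ℂ :=
  Matrix.of fun m n => (L : ℂ)⁻¹ * ∑ l : Fin L,
    ∫ ω, M.sens s' ((l : ℝ) + 1) ω m * star (M.sens s' ((l : ℝ) + 1) ω n) ∂P

/-- Transmit covariance `∑_k a_{s',k} w_{s',k} w_{s',k}ᴴ + R_{s'}` of a transmitting base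
station. -/
noncomputable def txCov (s' : Fin S) : Matrix (Fin N) (Fin N) ℂ :=
  (∑ k, (if M.assoc s' k then 1 else 0 : ℂ) • vecMulVec (M.beam s' k) (star (M.beam s' k))) +
    M.sensCov P s'

/-- Second-order statistics over the delayed window, averaged over the `L` slots and the
randomness: the communication signals have unit power and are mutually uncorrelated, they are
uncorrelated with the sensing signals, the sensing signals of distinct base stations are
uncorrelated, and the covariance of each is not affected by the delay. -/
structure SignalStatistics (s : Fin S) (p : Plane) : Prop where
  sym_sym : ∀ (s₁ s₂ : Tx s) (k₁ k₂ : Fin K),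
    (L : ℂ)⁻¹ * ∑ l : Fin L, ∫ ω, M.sym s₁ k₁ (M.instant s s₁ p l) ω *
        star (M.sym s₂ k₂ (M.instant s s₂ p l) ω) ∂P =
      if s₁ = s₂ ∧ k₁ = k₂ then 1 else 0
  sym_sens : ∀ (s₁ s₂ : Tx s) (k : Fin K) (n : Fin N),
    (L : ℂ)⁻¹ * ∑ l : Fin L, ∫ ω, M.sym s₁ k (M.instant s s₁ p l) ω *
        star (M.sens s₂ (M.instant s s₂ p l) ω n) ∂P = 0
  sens_sens : ∀ (s₁ s₂ : Tx s) (m n : Fin N),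
    (L : ℂ)⁻¹ * ∑ l : Fin L, ∫ ω, M.sens s₁ (M.instant s s₁ p l) ω m *
        star (M.sens s₂ (M.instant s s₂ p l) ω n) ∂P =
      if s₁ = s₂ then M.sensCov P s₁ m n else 0

/-- Derivative `τ̇^{(i)}_{s,s'}` of the delay in `p_i`. -/
noncomputable def delayDeriv (s s' : Fin S) (p : Plane) (i : Fin 2) : ℝ :=
  partialDeriv (M.delay s s') p i

/-- The convention `∂X_{s,s'}/∂p_i = -τ̇^{(i)}_{s,s'} X_{s,s'}` for the delayed signals. -/
def DelayConvention (s : Fin S) (p : Plane) : Prop :=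
  ∀ᵐ ω ∂P, ∀ (s' : Tx s) (i : Fin 2) (n : Fin N) (l : Fin L),
    partialDeriv (fun q => M.delayed s s' ω q n l) p i =
      -(M.delayDeriv s s' p i : ℂ) * M.delayed s s' ω p n l

/-- Derivative `ȧ^{(i)}(θ_s)` of the steering vector in `p_i`. -/
noncomputable def steeringDeriv (s : Fin S) (p : Plane) (i : Fin 2) : Fin N → ℂ :=
  partialDeriv (fun q => steering N (M.angle s q)) p i

/-- `Ġ^{(i)}_{s,s'} = ȧ^{(i)}(θ_{r,s}) a(θ_{t,s'})ᴴ + a(θ_{r,s}) ȧ^{(i)}(θ_{t,s'})ᴴ`. -/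
noncomputable def responseDeriv (s s' : Fin S) (p : Plane) (i : Fin 2) :
    Matrix (Fin N) (Fin N) ℂ :=
  vecMulVec (M.steeringDeriv s p i) (star (steering N (M.angle s' p))) +
    vecMulVec (steering N (M.angle s p)) (star (M.steeringDeriv s' p i))

/-- `G̃^{(i)}_{s,s'} = Ġ^{(i)}_{s,s'} - τ̇^{(i)}_{s,s'} G_{s,s'}`. -/
noncomputable def responseTilde (s s' : Fin S) (p : Plane) (i : Fin 2) :
    Matrix (Fin N) (Fin N) ℂ :=
  M.responseDeriv s s' p i - (M.delayDeriv s s' p i : ℂ) • M.response s s' p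

/-- The factor `2L/σ²`. -/
noncomputable def snrFactor (s : Fin S) : ℝ := 2 * (L : ℝ) / M.noise s ^ 2

/-- Explicit position block. -/
noncomputable def Fpp (s : Fin S) (ξ : Param s) : Matrix (Fin 2) (Fin 2) ℝ :=
  M.snrFactor s • Matrix.of fun i j =>
    (Matrix.trace (∑ s' : Tx s, ((‖gain ξ s'‖ ^ 2 : ℝ) : ℂ) •
      (M.responseTilde s s' (target ξ) j * M.txCov P s' *
        (M.responseTilde s s' (target ξ) i)ᴴ))).re

/-- The `2 × (S-1)` matrix `D`. -/
noncomputable def Dmat (s : Fin S) (ξ : Param s) : Matrix (Fin 2) (Tx s) ℂ :=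
  Matrix.of fun i s' => star (gain ξ s') *
    Matrix.trace (M.response s s' (target ξ) * M.txCov P s' *
      (M.responseTilde s s' (target ξ) i)ᴴ)

/-- Explicit mixed block `(2L/σ²) Re([1, j] ⊗ D)`. -/
noncomputable def Fpa (s : Fin S) (ξ : Param s) : Matrix (Fin 2) (Tx s ⊕ Tx s) ℝ :=
  M.snrFactor s • (Matrix.fromCols (M.Dmat P s ξ) (Complex.I • M.Dmat P s ξ)).map Complex.re

/-- The diagonal matrix `E` with entries `tr(G_{s,s'} Q_{s'} G_{s,s'}ᴴ)` (which are real). -/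
noncomputable def Emat (s : Fin S) (ξ : Param s) : Matrix (Tx s) (Tx s) ℝ :=
  Matrix.diagonal fun s' =>
    (Matrix.trace (M.response s s' (target ξ) * M.txCov P s' *
      (M.response s s' (target ξ))ᴴ)).re

/-- Explicit gain block `(2L/σ²) I₂ ⊗ E`. -/
noncomputable def Faa (s : Fin S) (ξ : Param s) : Matrix (Tx s ⊕ Tx s) (Tx s ⊕ Tx s) ℝ :=
  M.snrFactor s • Matrix.fromBlocks (M.Emat P s ξ) 0 0 (M.Emat P s ξ)

end IsacNetwork

/-
Given the transmitted signals, the echo is its noise-free mean plus a circular Gaussian vector, so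
each score is `2/σ²` times the real inner product of the noise with a derivative of the mean.
Circularity makes the two quadratures of the noise uncorrelated with equal variances, hence the
Fisher information is `2/σ²` times the expected real inner products of the derivatives of the mean.

The Fisher information is also the Gram matrix of the scores in `L²`. Unbiasedness along each line
through `ξ` says that the error of a coordinate of the estimator has inner product `0` or `1` with
each score, and Bessel's inequality for the span of the scores is then the Cramér–Rao bound. A
positive semidefinite invertible matrix is positive definite, so its principal blocks are
invertible and the position block of its inverse is the inverse of a Schur complement.

Under the delay convention every derivative of the mean is a sum over `s'` of matrices applied to
the delayed signals, whose cross moments vanish for distinct base stations and are otherwise the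
transmit covariance; expanding the inner products gives traces, block by block.
-/

section Schur

open scoped ComplexOrder

variable {m n α : Type*}

lemma toBlocks₂₁_eq_transpose_toBlocks₁₂ {F : Matrix (m ⊕ n) (m ⊕ n) α} (hF : F.IsSymm) :
    F.toBlocks₂₁ = F.toBlocks₁₂ᵀ :=
  Matrix.ext fun _ _ => hF.apply _ _

variable [Fintype m] [Fintype n] [DecidableEq m] [DecidableEq n]

lemma isUnit_det_toBlocks₂₂ {𝕜 : Type*} [RCLike 𝕜] {F : Matrix (m ⊕ n) (m ⊕ n) 𝕜}
    (hF : F.PosSemidef) (hdet : IsUnit F.det) : IsUnit F.toBlocks₂₂.det := by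
  rw [← Matrix.isUnit_iff_isUnit_det] at hdet ⊢
  exact ((hF.posDef_iff_isUnit.2 hdet).submatrix Sum.inr_injective).isUnit

variable [CommRing α] {F : Matrix (m ⊕ n) (m ⊕ n) α}

lemma isUnit_det_schur (hdet : IsUnit F.det) (h₂₂ : IsUnit F.toBlocks₂₂.det) :
    IsUnit (F.toBlocks₁₁ - F.toBlocks₁₂ * F.toBlocks₂₂⁻¹ * F.toBlocks₂₁).det := by
  let _ := Matrix.invertibleOfIsUnitDet _ h₂₂
  rwa [← Matrix.isUnit_iff_isUnit_det, ← Matrix.invOf_eq_nonsing_inv,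
    ← Matrix.isUnit_fromBlocks_iff_of_invertible₂₂, Matrix.fromBlocks_toBlocks,
    Matrix.isUnit_iff_isUnit_det]

lemma toBlocks₁₁_inv (hdet : IsUnit F.det) (h₂₂ : IsUnit F.toBlocks₂₂.det) :
    F⁻¹.toBlocks₁₁ = (F.toBlocks₁₁ - F.toBlocks₁₂ * F.toBlocks₂₂⁻¹ * F.toBlocks₂₁)⁻¹ := by
  have hS := isUnit_det_schur hdet h₂₂
  let _ := Matrix.invertibleOfIsUnitDet _ h₂₂
  rw [← Matrix.invOf_eq_nonsing_inv F.toBlocks₂₂] at hS ⊢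
  let _ := Matrix.invertibleOfIsUnitDet _ hS
  let _ := Matrix.fromBlocks₂₂Invertible F.toBlocks₁₁ F.toBlocks₁₂ F.toBlocks₂₁ F.toBlocks₂₂
  have h := Matrix.invOf_fromBlocks₂₂_eq F.toBlocks₁₁ F.toBlocks₁₂ F.toBlocks₂₁ F.toBlocks₂₂
  rw [Matrix.invOf_eq_nonsing_inv, Matrix.fromBlocks_toBlocks] at h
  rw [h, Matrix.toBlocks_fromBlocks₁₁, Matrix.invOf_eq_nonsing_inv _]

end Schur

section Gram

variable {ι 𝕜 E : Type*} [Fintype ι] [DecidableEq ι] [RCLike 𝕜]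

/- The left-hand side is the squared norm of the orthogonal projection of `u` onto the span of
`v`. -/
lemma re_dotProduct_inv_gram_mulVec_le [SeminormedAddCommGroup E] [InnerProductSpace 𝕜 E]
    {v : ι → E} (hv : IsUnit (Matrix.gram 𝕜 v).det) (u : E) :
    RCLike.re (star (fun i => inner 𝕜 (v i) u) ⬝ᵥ
      (Matrix.gram 𝕜 v)⁻¹ *ᵥ fun i => inner 𝕜 (v i) u) ≤ ‖u‖ ^ 2 := by
  set b : ι → 𝕜 := fun i => inner 𝕜 (v i) u with hb
  set x : ι → 𝕜 := (Matrix.gram 𝕜 v)⁻¹ *ᵥ b with hx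
  set w : E := ∑ i, x i • v i with hw
  have hGx : Matrix.gram 𝕜 v *ᵥ x = b := by
    rw [hx, Matrix.mulVec_mulVec, Matrix.mul_nonsing_inv _ hv, Matrix.one_mulVec]
  have hwu : inner 𝕜 w u = star x ⬝ᵥ b := by
    simp only [hw, sum_inner, inner_smul_left, hb, dotProduct, Pi.star_apply, RCLike.star_def]
  have hww : inner 𝕜 w w = star x ⬝ᵥ b := by
    rw [hw, ← Matrix.star_dotProduct_gram_mulVec, hGx]
  have hre : RCLike.re (star b ⬝ᵥ x) = ‖w‖ ^ 2 := by
    rw [← inner_self_eq_norm_sq (𝕜 := 𝕜), hww, Matrix.star_dotProduct, RCLike.star_def,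
      RCLike.conj_re]
  have hle : ‖w‖ ^ 2 ≤ ‖w‖ * ‖u‖ := by
    rw [← inner_self_eq_norm_sq (𝕜 := 𝕜), hww, ← hwu]
    exact re_inner_le_norm w u
  rw [hre]
  nlinarith [sq_nonneg (‖w‖ - ‖u‖)]

end Gram

section ComplexGaussian

variable {ι : Type*} [Fintype ι]

/-- The real part of the Hermitian inner product of two complex vectors, as a real bilinear map. -/
noncomputable def reInner : (ι → ℂ) →L[ℝ] (ι → ℂ) →L[ℝ] ℝ :=
  let toL2 := (PiLp.continuousLinearEquiv 2 ℝ fun _ : ι => ℂ).symm.toContinuousLinearMap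
  (innerSL ℝ).bilinearComp toL2 toL2

lemma reInner_apply (u v : ι → ℂ) : reInner u v = ∑ m, inner ℝ (u m) (v m) :=
  PiLp.inner_apply _ _

lemma reInner_comm (u v : ι → ℂ) : reInner u v = reInner v u := by
  simp only [reInner_apply, real_inner_comm]

lemma reInner_self (u : ι → ℂ) : reInner u u = ∑ m, ‖u m‖ ^ 2 := by
  simp only [reInner_apply, real_inner_self_eq_norm_sq]

lemma reInner_self_nonneg (u : ι → ℂ) : 0 ≤ reInner u u := by
  rw [reInner_self]
  positivity

/-- The density of the circularly symmetric complex Gaussian vector with covariance `σ² I`. -/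
noncomputable def complexGaussianPDF (σ : ℝ) (w : ι → ℂ) : ℝ :=
  ((Real.pi * σ ^ 2) ^ Fintype.card ι)⁻¹ * Real.exp (-reInner w w / σ ^ 2)

lemma complexGaussianPDF_nonneg (σ : ℝ) (w : ι → ℂ) : 0 ≤ complexGaussianPDF σ w := by
  have := Real.pi_pos
  unfold complexGaussianPDF
  positivity

lemma measurable_complexGaussianPDF (σ : ℝ) :
    Measurable (complexGaussianPDF σ : (ι → ℂ) → ℝ) := by
  unfold complexGaussianPDF
  fun_prop

/-- The law of the circularly symmetric complex Gaussian vector with covariance `σ² I`. -/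
noncomputable def complexGaussian (ι : Type*) [Fintype ι] (σ : ℝ) : Measure (ι → ℂ) :=
  volume.withDensity fun w => ENNReal.ofReal (complexGaussianPDF σ w)

instance (σ : ℝ) : SFinite (complexGaussian ι σ) := by
  unfold complexGaussian
  infer_instance

lemma integral_exp_neg_mul_reInner_self {b : ℝ} (hb : 0 < b) :
    ∫ w : ι → ℂ, Real.exp (-b * reInner w w) = (Real.pi / b) ^ Fintype.card ι := by
  simp_rw [reInner_self, Finset.mul_sum, Real.exp_sum]
  rw [integral_fintype_prod_volume_eq_prod fun _ (z : ℂ) => Real.exp (-b * ‖z‖ ^ 2),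
    GaussianFourier.integral_rexp_neg_mul_sq_norm hb]
  simp [div_pow]

lemma integral_complexGaussianPDF {σ : ℝ} (hσ : σ ≠ 0) :
    ∫ w : ι → ℂ, complexGaussianPDF σ w = 1 := by
  have hπ : Real.pi * σ ^ 2 ≠ 0 := mul_ne_zero Real.pi_ne_zero (pow_ne_zero 2 hσ)
  simp only [complexGaussianPDF, integral_const_mul, div_eq_inv_mul, mul_neg, ← neg_mul]
  rw [integral_exp_neg_mul_reInner_self (by positivity), div_inv_eq_mul,
    inv_mul_cancel₀ (pow_ne_zero _ hπ)]

lemma isProbabilityMeasure_complexGaussian {σ : ℝ} (hσ : σ ≠ 0) :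
    IsProbabilityMeasure (complexGaussian ι σ) where
  measure_univ := by
    rw [complexGaussian, withDensity_apply _ MeasurableSet.univ, Measure.restrict_univ,
      ← ofReal_integral_eq_lintegral_ofReal
        (.of_integral_ne_zero (by rw [integral_complexGaussianPDF hσ]; exact one_ne_zero))
        (ae_of_all _ (complexGaussianPDF_nonneg σ)),
      integral_complexGaussianPDF hσ, ENNReal.ofReal_one]

/-- The likelihood ratio between the complex Gaussian vector shifted by `δ` and the centred one. -/
noncomputable def shiftRatio (σ : ℝ) (δ w : ι → ℂ) : ℝ :=
  Real.exp ((2 * reInner w δ - reInner δ δ) / σ ^ 2)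

lemma measurable_shiftRatio (σ : ℝ) (δ : ι → ℂ) : Measurable (shiftRatio σ δ) := by
  unfold shiftRatio
  fun_prop

lemma complexGaussianPDF_sub (σ : ℝ) (w δ : ι → ℂ) :
    complexGaussianPDF σ (w - δ) = complexGaussianPDF σ w * shiftRatio σ δ w := by
  rw [complexGaussianPDF, complexGaussianPDF, shiftRatio, mul_assoc, ← Real.exp_add]
  simp only [map_sub, _root_.sub_apply, reInner_comm δ w]
  ring_nf

lemma map_add_right_complexGaussian (σ : ℝ) (c : ι → ℂ) :
    (complexGaussian ι σ).map (· + c) =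
      volume.withDensity fun w => ENNReal.ofReal (complexGaussianPDF σ (w - c)) := by
  ext A hA
  have hpre : MeasurableSet ((· + c) ⁻¹' A) := measurable_add_const c hA
  rw [Measure.map_apply (measurable_add_const c) hA, complexGaussian, withDensity_apply _ hpre,
    withDensity_apply _ hA, ← lintegral_indicator hpre, ← lintegral_indicator hA,
    ← lintegral_add_right_eq_self (A.indicator _) c]
  simp only [Set.indicator, add_sub_cancel_right]
  rfl

lemma map_add_right_complexGaussian_eq_withDensity_shiftRatio (σ : ℝ) (δ : ι → ℂ) :
    (complexGaussian ι σ).map (· + δ) =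
      (complexGaussian ι σ).withDensity fun w => ENNReal.ofReal (shiftRatio σ δ w) := by
  rw [map_add_right_complexGaussian, complexGaussian, ← withDensity_mul _
    (measurable_complexGaussianPDF σ).ennreal_ofReal (measurable_shiftRatio σ δ).ennreal_ofReal]
  simp only [complexGaussianPDF_sub, ENNReal.ofReal_mul (complexGaussianPDF_nonneg σ _), Pi.mul_def]

lemma integrable_mul_shiftRatio_iff (σ : ℝ) (δ : ι → ℂ) (f : (ι → ℂ) → ℝ) :
    Integrable (fun w => f w * shiftRatio σ δ w) (complexGaussian ι σ) ↔
      Integrable (fun w => f (w + δ)) (complexGaussian ι σ) := by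
  have h := (measurableEmbedding_addRight δ).integrable_map_iff (μ := complexGaussian ι σ) (g := f)
  rw [map_add_right_complexGaussian_eq_withDensity_shiftRatio,
    integrable_withDensity_iff (measurable_shiftRatio σ δ).ennreal_ofReal
      (ae_of_all _ fun _ => ENNReal.ofReal_lt_top)] at h
  simpa only [shiftRatio, ENNReal.toReal_ofReal (Real.exp_nonneg _), Function.comp_def] using h

lemma integral_mul_shiftRatio (σ : ℝ) (δ : ι → ℂ) (f : (ι → ℂ) → ℝ) :
    ∫ w, f w * shiftRatio σ δ w ∂complexGaussian ι σ = ∫ w, f (w + δ) ∂complexGaussian ι σ := by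
  have h := (measurableEmbedding_addRight δ).integral_map (μ := complexGaussian ι σ) f
  rw [map_add_right_complexGaussian_eq_withDensity_shiftRatio,
    integral_withDensity_eq_integral_toReal_smul (measurable_shiftRatio σ δ).ennreal_ofReal
      (ae_of_all _ fun _ => ENNReal.ofReal_lt_top)] at h
  simpa only [shiftRatio, ENNReal.toReal_ofReal (Real.exp_nonneg _), smul_eq_mul,
    mul_comm (Real.exp _)] using h

variable {σ : ℝ} (hσ : σ ≠ 0)
include hσ

lemma integrable_shiftRatio (δ : ι → ℂ) : Integrable (shiftRatio σ δ) (complexGaussian ι σ) := by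
  have := isProbabilityMeasure_complexGaussian (ι := ι) hσ
  simpa using (integrable_mul_shiftRatio_iff σ δ fun _ => 1).2 (integrable_const 1)

lemma integral_shiftRatio (δ : ι → ℂ) : ∫ w, shiftRatio σ δ w ∂complexGaussian ι σ = 1 := by
  have := isProbabilityMeasure_complexGaussian (ι := ι) hσ
  simpa using integral_mul_shiftRatio σ δ fun _ => 1

end ComplexGaussian

section SquareIntegrable

variable {α : Type*} [MeasurableSpace α] {μ : Measure α} {f g : α → ℝ}

lemma inner_toLp (hf : MemLp f 2 μ) (hg : MemLp g 2 μ) :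
    inner ℝ (hf.toLp f) (hg.toLp g) = ∫ x, f x * g x ∂μ := by
  rw [L2.inner_def]
  refine integral_congr_ae ?_
  filter_upwards [hf.coeFn_toLp, hg.coeFn_toLp] with x hfx hgx
  rw [hfx, hgx, real_inner_eq_re_inner, RCLike.inner_apply, conj_trivial, mul_comm]
  rfl

lemma sq_integral_mul_le (hf : MemLp f 2 μ) (hg : MemLp g 2 μ) :
    (∫ x, f x * g x ∂μ) ^ 2 ≤ (∫ x, f x ^ 2 ∂μ) * ∫ x, g x ^ 2 ∂μ := by
  simpa only [inner_toLp, sq] using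
    real_inner_mul_inner_self_le (hf.toLp f) (hg.toLp g)

end SquareIntegrable

section ComplexGaussianMoments

open ProbabilityTheory

variable {ι : Type*} [Fintype ι] {σ : ℝ} (hσ : σ ≠ 0)
include hσ

lemma exp_mul_reInner_eq_mul_shiftRatio (t : ℝ) (v w : ι → ℂ) :
    Real.exp (t * reInner w v) = Real.exp (σ ^ 2 / 2 * reInner v v * t ^ 2 / 2) *
      shiftRatio σ ((t * σ ^ 2 / 2) • v) w := by
  rw [shiftRatio, ← Real.exp_add]
  congr 1
  simp only [map_smul, smul_eq_mul, _root_.smul_apply]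
  field_simp
  ring

lemma integrable_exp_mul_reInner (t : ℝ) (v : ι → ℂ) :
    Integrable (fun w => Real.exp (t * reInner w v)) (complexGaussian ι σ) := by
  simp only [exp_mul_reInner_eq_mul_shiftRatio hσ t v]
  exact (integrable_shiftRatio hσ _).const_mul _

lemma mgf_reInner (v : ι → ℂ) :
    mgf (fun w => reInner w v) (complexGaussian ι σ) =
      mgf id (gaussianReal 0 (σ ^ 2 / 2 * reInner v v).toNNReal) := by
  have hv : 0 ≤ σ ^ 2 / 2 * reInner v v := mul_nonneg (by positivity) (reInner_self_nonneg v)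
  ext t
  rw [mgf_id_gaussianReal, mgf]
  simp only [exp_mul_reInner_eq_mul_shiftRatio hσ t v]
  rw [integral_const_mul, integral_shiftRatio hσ, mul_one, Real.coe_toNNReal _ hv, zero_mul,
    zero_add]

lemma integrableExpSet_reInner (v : ι → ℂ) :
    integrableExpSet (fun w => reInner w v) (complexGaussian ι σ) = Set.univ :=
  Set.eq_univ_of_forall fun t => integrable_exp_mul_reInner hσ t v

lemma memLp_reInner (v : ι → ℂ) :
    MemLp (fun w => reInner w v) 2 (complexGaussian ι σ) :=
  memLp_of_mem_interior_integrableExpSet (by simp [integrableExpSet_reInner hσ]) 2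

lemma integral_reInner_pow (v : ι → ℂ) (n : ℕ) :
    ∫ w, reInner w v ^ n ∂complexGaussian ι σ =
      ∫ x, x ^ n ∂gaussianReal 0 (σ ^ 2 / 2 * reInner v v).toNNReal := by
  have h := iteratedDeriv_mgf_zero (X := fun w => reInner w v) (μ := complexGaussian ι σ)
    (by simp [integrableExpSet_reInner hσ]) n
  rw [mgf_reInner hσ, iteratedDeriv_mgf_zero (by simp)] at h
  exact h.symm

lemma integral_reInner (v : ι → ℂ) : ∫ w, reInner w v ∂complexGaussian ι σ = 0 := by
  simpa using integral_reInner_pow hσ v 1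

lemma integral_reInner_sq (v : ι → ℂ) :
    ∫ w, reInner w v ^ 2 ∂complexGaussian ι σ = σ ^ 2 / 2 * reInner v v := by
  have hv : 0 ≤ σ ^ 2 / 2 * reInner v v := mul_nonneg (by positivity) (reInner_self_nonneg v)
  have h := variance_id_gaussianReal (μ := 0) (v := (σ ^ 2 / 2 * reInner v v).toNNReal)
  rw [variance_of_integral_eq_zero aemeasurable_id integral_id_gaussianReal,
    Real.coe_toNNReal _ hv] at h
  exact (integral_reInner_pow hσ v 2).trans h

lemma integral_reInner_mul_reInner (u v : ι → ℂ) :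
    ∫ w, reInner w u * reInner w v ∂complexGaussian ι σ = σ ^ 2 / 2 * reInner u v := by
  have polarization : ∀ w : ι → ℂ, reInner w u * reInner w v =
      (reInner w (u + v) ^ 2 - reInner w u ^ 2 - reInner w v ^ 2) / 2 := fun w => by
    rw [map_add]
    ring
  have huv := (memLp_reInner hσ (u + v)).integrable_sq
  have hu := (memLp_reInner hσ u).integrable_sq
  have hv := (memLp_reInner hσ v).integrable_sq
  have huvu : Integrable (fun w => reInner w (u + v) ^ 2 - reInner w u ^ 2)
      (complexGaussian ι σ) := huv.sub hu
  rw [integral_congr_ae (.of_forall polarization), integral_div, integral_sub huvu hv,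
    integral_sub huv hu, integral_reInner_sq hσ, integral_reInner_sq hσ, integral_reInner_sq hσ]
  simp only [map_add, _root_.add_apply, reInner_comm v u]
  ring

end ComplexGaussianMoments

section QuadraticMean

variable {ι : Type*} [Fintype ι] {σ : ℝ}

lemma shiftRatio_sq (δ w : ι → ℂ) :
    shiftRatio σ δ w ^ 2 =
      Real.exp (2 / σ ^ 2 * reInner δ δ) * shiftRatio σ ((2 : ℝ) • δ) w := by
  rw [shiftRatio, shiftRatio, ← Real.exp_nat_mul, ← Real.exp_add]
  congr 1
  simp only [map_smul, smul_eq_mul, _root_.smul_apply]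
  push_cast
  ring

variable (hσ : σ ≠ 0)
include hσ

lemma memLp_shiftRatio (δ : ι → ℂ) : MemLp (shiftRatio σ δ) 2 (complexGaussian ι σ) := by
  rw [memLp_two_iff_integrable_sq (measurable_shiftRatio σ δ).aestronglyMeasurable]
  simp only [shiftRatio_sq]
  exact (integrable_shiftRatio hσ _).const_mul _

lemma integral_shiftRatio_sq (δ : ι → ℂ) :
    ∫ w, shiftRatio σ δ w ^ 2 ∂complexGaussian ι σ = Real.exp (2 / σ ^ 2 * reInner δ δ) := by
  simp only [shiftRatio_sq]
  rw [integral_const_mul, integral_shiftRatio hσ, mul_one]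

lemma integral_reInner_mul_shiftRatio (δ v : ι → ℂ) :
    ∫ w, reInner w v * shiftRatio σ δ w ∂complexGaussian ι σ = reInner δ v := by
  have := isProbabilityMeasure_complexGaussian (ι := ι) hσ
  rw [integral_mul_shiftRatio σ δ fun w => reInner w v]
  simp only [map_add, _root_.add_apply]
  rw [integral_add ((memLp_reInner hσ v).integrable one_le_two) (integrable_const _),
    integral_reInner hσ, zero_add]
  simp

/-- The remainder of the first-order expansion of the likelihood ratio `shiftRatio σ δ` at
`δ = 0`. -/
noncomputable def shiftRemainder (σ : ℝ) (δ w : ι → ℂ) : ℝ :=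
  shiftRatio σ δ w - 1 - 2 / σ ^ 2 * reInner w δ

lemma memLp_shiftRemainder (δ : ι → ℂ) :
    MemLp (shiftRemainder σ δ) 2 (complexGaussian ι σ) := by
  have := isProbabilityMeasure_complexGaussian (ι := ι) hσ
  exact ((memLp_shiftRatio hσ δ).sub (memLp_const 1)).sub ((memLp_reInner hσ δ).const_mul _)

lemma integral_shiftRemainder_sq (δ : ι → ℂ) :
    ∫ w, shiftRemainder σ δ w ^ 2 ∂complexGaussian ι σ =
      Real.exp (2 / σ ^ 2 * reInner δ δ) - 1 - 2 / σ ^ 2 * reInner δ δ := by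
  have := isProbabilityMeasure_complexGaussian (ι := ι) hσ
  set a : ℝ := 2 / σ ^ 2 with ha
  have hρ := integrable_shiftRatio hσ δ
  have hρ2 := (memLp_shiftRatio hσ δ).integrable_sq
  have hℓ : Integrable (fun w => reInner w δ) (complexGaussian ι σ) :=
    (memLp_reInner hσ δ).integrable one_le_two
  have hℓ2 := (memLp_reInner hσ δ).integrable_sq
  have hℓρ : Integrable (fun w => reInner w δ * shiftRatio σ δ w) (complexGaussian ι σ) :=
    (memLp_reInner hσ δ).integrable_mul (memLp_shiftRatio hσ δ)
  have expand : ∀ w, shiftRemainder σ δ w ^ 2 = shiftRatio σ δ w ^ 2 + 1 +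
      a ^ 2 * reInner w δ ^ 2 - 2 * shiftRatio σ δ w -
      2 * a * (reInner w δ * shiftRatio σ δ w) + 2 * a * reInner w δ := fun w => by
    rw [shiftRemainder, ← ha]
    ring
  simp only [expand]
  rw [integral_add (by fun_prop) (by fun_prop), integral_sub (by fun_prop) (by fun_prop),
    integral_sub (by fun_prop) (by fun_prop), integral_add (by fun_prop) (by fun_prop),
    integral_add (by fun_prop) (by fun_prop)]
  simp only [integral_const_mul, integral_shiftRatio_sq hσ, integral_reInner_sq hσ,
    integral_shiftRatio hσ, integral_reInner_mul_shiftRatio hσ, integral_reInner hσ, ← ha]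
  have haσ : a * σ ^ 2 = 2 := div_mul_cancel₀ _ (pow_ne_zero 2 hσ)
  simp only [integral_const, probReal_univ, smul_eq_mul, mul_one, mul_zero, add_zero]
  linear_combination (a * reInner δ δ / 2) * haσ

lemma abs_integral_mul_shiftRemainder_le {f : (ι → ℂ) → ℝ} (hf : MemLp f 2 (complexGaussian ι σ))
    {δ : ι → ℂ} (hδ : 2 / σ ^ 2 * reInner δ δ ≤ 1) :
    |∫ w, f w * shiftRemainder σ δ w ∂complexGaussian ι σ| ≤
      √(∫ w, f w ^ 2 ∂complexGaussian ι σ) * (2 / σ ^ 2 * reInner δ δ) := by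
  have hx : 0 ≤ 2 / σ ^ 2 * reInner δ δ := mul_nonneg (by positivity) (reInner_self_nonneg δ)
  have hexp := (le_abs_self _).trans
    (Real.abs_exp_sub_one_sub_id_le ((abs_of_nonneg hx).trans_le hδ))
  refine abs_le_of_sq_le_sq ?_ (by positivity)
  calc (∫ w, f w * shiftRemainder σ δ w ∂complexGaussian ι σ) ^ 2
      ≤ (∫ w, f w ^ 2 ∂complexGaussian ι σ) *
          (Real.exp (2 / σ ^ 2 * reInner δ δ) - 1 - 2 / σ ^ 2 * reInner δ δ) :=
        (sq_integral_mul_le hf (memLp_shiftRemainder hσ δ)).trans_eq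
          (by rw [integral_shiftRemainder_sq hσ])
    _ ≤ (∫ w, f w ^ 2 ∂complexGaussian ι σ) * (2 / σ ^ 2 * reInner δ δ) ^ 2 := by gcongr
    _ = _ := by rw [mul_pow √_, Real.sq_sqrt (by positivity)]

lemma isLittleO_integral_mul_shiftRemainder {f : (ι → ℂ) → ℝ}
    (hf : MemLp f 2 (complexGaussian ι σ)) :
    (fun δ => ∫ w, f w * shiftRemainder σ δ w ∂complexGaussian ι σ) =o[𝓝 0] fun δ => δ := by
  have hcont : Continuous fun δ : ι → ℂ => 2 / σ ^ 2 * reInner δ δ := by fun_prop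
  have hsmall : ∀ᶠ δ : ι → ℂ in 𝓝 0, 2 / σ ^ 2 * reInner δ δ ≤ 1 :=
    (hcont.tendsto' 0 0 (by simp)).eventually_le_const one_pos
  have hquad : (fun δ : ι → ℂ => 2 / σ ^ 2 * reInner δ δ) =O[𝓝 0] fun δ => ‖δ‖ ^ 2 :=
    .of_bound (2 / σ ^ 2 * ‖reInner (ι := ι)‖) <| .of_forall fun δ => by
      rw [norm_mul, Real.norm_of_nonneg (by positivity), mul_assoc, norm_pow, norm_norm,
        pow_two ‖δ‖, ← mul_assoc ‖reInner (ι := ι)‖]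
      gcongr
      exact reInner.le_opNorm₂ δ δ
  refine (Asymptotics.IsBigO.of_bound √(∫ w, f w ^ 2 ∂complexGaussian ι σ) ?_).trans_isLittleO
    (hquad.trans_isLittleO (Asymptotics.isLittleO_norm_pow_id one_lt_two))
  filter_upwards [hsmall] with δ hδ
  exact (abs_integral_mul_shiftRemainder_le hσ hf hδ).trans
    (mul_le_mul_of_nonneg_left (le_abs_self _) (Real.sqrt_nonneg _))

lemma exists_clm_eq_integral_mul_reInner {f : (ι → ℂ) → ℝ}
    (hf : MemLp f 2 (complexGaussian ι σ)) :
    ∃ A : (ι → ℂ) →L[ℝ] ℝ, ∀ v, A v = ∫ w, f w * reInner w v ∂complexGaussian ι σ := by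
  have hint : ∀ v, Integrable (fun w => f w * reInner w v) (complexGaussian ι σ) :=
    fun v => hf.integrable_mul (memLp_reInner hσ v)
  let A : (ι → ℂ) →ₗ[ℝ] ℝ :=
    { toFun := fun v => ∫ w, f w * reInner w v ∂complexGaussian ι σ
      map_add' := fun u v => by
        simp only [map_add, mul_add]
        exact integral_add (hint u) (hint v)
      map_smul' := fun t v => by
        simp only [map_smul, smul_eq_mul, mul_left_comm _ t, integral_const_mul, RingHom.id_apply] }
  exact ⟨A.toContinuousLinearMap, fun _ => rfl⟩

lemma integral_mul_shiftRatio_eq_add {f : (ι → ℂ) → ℝ} (hf : MemLp f 2 (complexGaussian ι σ))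
    (δ : ι → ℂ) :
    ∫ w, f w * shiftRatio σ δ w ∂complexGaussian ι σ =
      ∫ w, f w ∂complexGaussian ι σ +
        2 / σ ^ 2 * ∫ w, f w * reInner w δ ∂complexGaussian ι σ +
        ∫ w, f w * shiftRemainder σ δ w ∂complexGaussian ι σ := by
  have := isProbabilityMeasure_complexGaussian (ι := ι) hσ
  have hf1 : Integrable f (complexGaussian ι σ) := hf.integrable one_le_two
  have hℓ : Integrable (fun w => 2 / σ ^ 2 * (f w * reInner w δ)) (complexGaussian ι σ) :=
    (hf.integrable_mul (memLp_reInner hσ δ)).const_mul _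
  have hr : Integrable (fun w => f w * shiftRemainder σ δ w) (complexGaussian ι σ) :=
    hf.integrable_mul (memLp_shiftRemainder hσ δ)
  rw [← integral_const_mul, ← integral_add hf1 hℓ, ← integral_add (by fun_prop) hr]
  congr 1 with w
  rw [shiftRemainder]
  ring

lemma hasDerivAt_integral_comp_add {f : (ι → ℂ) → ℝ} (hf : MemLp f 2 (complexGaussian ι σ))
    {c : ℝ → ι → ℂ} {v : ι → ℂ} (hc0 : c 0 = 0) (hc : HasDerivAt c v 0) :
    HasDerivAt (fun t => ∫ w, f (w + c t) ∂complexGaussian ι σ)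
      (∫ w, f w * (2 / σ ^ 2 * reInner w v) ∂complexGaussian ι σ) 0 := by
  obtain ⟨A, hA⟩ := exists_clm_eq_integral_mul_reInner hσ hf
  have hfderiv : HasFDerivAt (fun δ => ∫ w, f (w + δ) ∂complexGaussian ι σ)
      ((2 / σ ^ 2) • A) 0 := by
    rw [hasFDerivAt_iff_isLittleO_nhds_zero]
    refine (isLittleO_integral_mul_shiftRemainder hσ hf).congr_left fun δ => ?_
    rw [← integral_mul_shiftRatio, integral_mul_shiftRatio_eq_add hσ hf, zero_add]
    simp only [_root_.smul_apply, hA, smul_eq_mul, add_zero]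
    ring
  rw [← hc0] at hfderiv
  refine (hfderiv.comp_hasDerivAt 0 hc).congr_deriv ?_
  simp only [_root_.smul_apply, hA, smul_eq_mul, mul_left_comm _ (2 / σ ^ 2), integral_const_mul]

end QuadraticMean

section GaussianChannel

variable {ι : Type*} [Fintype ι] {σ : ℝ}

lemma hasDerivAt_log_complexGaussianPDF_sub (hσ : σ ≠ 0) (y : ι → ℂ) {c : ℝ → ι → ℂ} {v : ι → ℂ}
    {t : ℝ} (hc : HasDerivAt c v t) :
    HasDerivAt (fun t => Real.log (complexGaussianPDF σ (y - c t)))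
      (2 / σ ^ 2 * reInner (y - c t) v) t := by
  have hconst : ((Real.pi * σ ^ 2) ^ Fintype.card ι)⁻¹ ≠ 0 :=
    inv_ne_zero (pow_ne_zero _ (mul_ne_zero Real.pi_ne_zero (pow_ne_zero 2 hσ)))
  have hquad := HasDerivAt.fun_sum (u := Finset.univ) fun m _ =>
    ((hasDerivAt_pi.1 hc m).const_sub (y m)).norm_sq
  simp only [complexGaussianPDF, Real.log_mul hconst (Real.exp_ne_zero _), Real.log_exp,
    reInner_self, Pi.sub_apply]
  refine ((hquad.neg.div_const (σ ^ 2)).const_add _).congr_deriv ?_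
  simp only [reInner_apply, Pi.sub_apply, inner_neg_right, mul_neg, Finset.sum_neg_distrib,
    ← Finset.mul_sum]
  ring

variable {Ω : Type*} [MeasurableSpace Ω] {P : Measure Ω} {m d e : Ω → ι → ℂ}

/-- The joint law of `ω` and `w + m ω`, for `ω` with law `P` and independent complex Gaussian noise
`w` with covariance `σ² I`. -/
noncomputable def gaussianChannel (P : Measure Ω) (σ : ℝ) (m : Ω → ι → ℂ) : Measure (Ω × (ι → ℂ)) :=
  (P.prod (complexGaussian ι σ)).map fun z => (z.1, z.2 + m z.1)

/-- The score of `gaussianChannel P σ m` along a direction of the parameter space in which the mean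
`m` has the derivative `d`. -/
noncomputable def gaussianScore (σ : ℝ) (m d : Ω → ι → ℂ) (z : Ω × (ι → ℂ)) : ℝ :=
  2 / σ ^ 2 * reInner (z.2 - m z.1) (d z.1)

omit [MeasurableSpace Ω] in
lemma gaussianScore_add (ω : Ω) (w : ι → ℂ) :
    gaussianScore σ m d (ω, w + m ω) = 2 / σ ^ 2 * reInner w (d ω) := by
  rw [gaussianScore, add_sub_cancel_right]

lemma integrable_reInner (hd : MemLp d 2 P) (he : MemLp e 2 P) :
    Integrable (fun ω => reInner (d ω) (e ω)) P := by
  simp only [reInner_apply]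
  refine integrable_finsetSum _ fun i _ => memLp_one_iff_integrable.1 ?_
  exact MemLp.of_bilin (inner ℝ) 1 (hd.eval i) (he.eval i) ((hd.eval i).1.inner (he.eval i).1)
    (.of_forall fun ω => by simpa only [one_mul] using nnnorm_inner_le_nnnorm _ _)

omit [Fintype ι] in
lemma aemeasurable_prodMk_add {Q : Measure (ι → ℂ)} [SFinite Q] (hm : AEMeasurable m P) :
    AEMeasurable (fun z : Ω × (ι → ℂ) => (z.1, z.2 + m z.1)) (P.prod Q) :=
  measurable_fst.aemeasurable.prodMk (measurable_snd.aemeasurable.add hm.comp_fst)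

lemma withDensity_complexGaussianPDF_sub (hm : AEMeasurable m P) :
    ((P.prod volume).withDensity fun z => ENNReal.ofReal (complexGaussianPDF σ (z.2 - m z.1))) =
      gaussianChannel P σ m := by
  have hpdf := (measurable_complexGaussianPDF (ι := ι) σ).ennreal_ofReal
  have hdensity : AEMeasurable
      (fun z : Ω × (ι → ℂ) => ENNReal.ofReal (complexGaussianPDF σ (z.2 - m z.1)))
      (P.prod volume) :=
    hpdf.comp_aemeasurable (measurable_snd.aemeasurable.sub hm.comp_fst)
  refine Measure.ext_of_lintegral _ fun f hf => ?_
  rw [gaussianChannel, lintegral_map' hf.aemeasurable (aemeasurable_prodMk_add hm),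
    lintegral_prod (fun z => f (z.1, z.2 + m z.1))
      (hf.comp_aemeasurable (aemeasurable_prodMk_add hm)),
    lintegral_withDensity_eq_lintegral_mul₀ hdensity hf.aemeasurable,
    lintegral_prod _ (hdensity.mul hf.aemeasurable)]
  refine lintegral_congr fun ω => ?_
  have hfω : Measurable fun y => f (ω, y) := hf.comp measurable_prodMk_left
  rw [← lintegral_map hfω (measurable_add_const (m ω)), map_add_right_complexGaussian,
    lintegral_withDensity_eq_lintegral_mul _
      (by exact hpdf.comp (measurable_sub_const (m ω))) hfω]
  rfl

lemma isProbabilityMeasure_gaussianChannel {P : Measure Ω} [IsProbabilityMeasure P] (hσ : σ ≠ 0)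
    (hm : AEMeasurable m P) : IsProbabilityMeasure (gaussianChannel P σ m) :=
  have := isProbabilityMeasure_complexGaussian (ι := ι) hσ
  Measure.isProbabilityMeasure_map (aemeasurable_prodMk_add hm)

lemma quasiMeasurePreserving_fst_gaussianChannel (hm : AEMeasurable m P) :
    Measure.QuasiMeasurePreserving Prod.fst (gaussianChannel P σ m) P where
  measurable := measurable_fst
  absolutelyContinuous := by
    rw [gaussianChannel, AEMeasurable.map_map_of_aemeasurable measurable_fst.aemeasurable
      (aemeasurable_prodMk_add hm)]
    exact Measure.quasiMeasurePreserving_fst.absolutelyContinuous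

lemma aestronglyMeasurable_gaussianScore (hm : AEMeasurable m P) (hd : MemLp d 2 P) :
    AEStronglyMeasurable (gaussianScore σ m d) (gaussianChannel P σ m) := by
  have hfst := quasiMeasurePreserving_fst_gaussianChannel (σ := σ) hm
  have hsub : AEStronglyMeasurable (fun z : Ω × (ι → ℂ) => z.2 - m z.1) (gaussianChannel P σ m) :=
    measurable_snd.aestronglyMeasurable.sub
      (hm.aestronglyMeasurable.comp_quasiMeasurePreserving hfst)
  have hcont : Continuous fun p : (ι → ℂ) × (ι → ℂ) => reInner p.1 p.2 := by fun_prop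
  exact (hcont.comp_aestronglyMeasurable
    (hsub.prodMk (hd.1.comp_quasiMeasurePreserving hfst))).const_mul _

lemma integral_gaussianChannel [SFinite P] (hm : AEMeasurable m P) {f : Ω × (ι → ℂ) → ℝ}
    (hf : Integrable f (gaussianChannel P σ m)) :
    ∫ z, f z ∂gaussianChannel P σ m = ∫ ω, ∫ w, f (ω, w + m ω) ∂complexGaussian ι σ ∂P := by
  have hshear := aemeasurable_prodMk_add (Q := complexGaussian ι σ) hm
  rw [gaussianChannel, integral_map hshear hf.1]
  exact integral_prod _ (hf.comp_aemeasurable hshear)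

lemma ae_memLp_gaussianChannel_slice [SFinite P] (hm : AEMeasurable m P) {f : Ω × (ι → ℂ) → ℝ}
    (hf : MemLp f 2 (gaussianChannel P σ m)) :
    ∀ᵐ ω ∂P, MemLp (fun w => f (ω, w + m ω)) 2 (complexGaussian ι σ) := by
  have hf' := hf.comp_of_map (aemeasurable_prodMk_add hm)
  filter_upwards [hf'.1.prodMk_left, hf'.integrable_sq.prod_right_ae] with ω hmeas hint
  exact (memLp_two_iff_integrable_sq hmeas).2 hint

variable (hσ : σ ≠ 0)
include hσ

lemma memLp_gaussianScore (hm : AEMeasurable m P) (hd : MemLp d 2 P) :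
    MemLp (gaussianScore σ m d) 2 (gaussianChannel P σ m) := by
  have hshear := aemeasurable_prodMk_add (Q := complexGaussian ι σ) hm
  have hmeas := aestronglyMeasurable_gaussianScore (σ := σ) hm hd
  rw [gaussianChannel, memLp_map_measure_iff hmeas hshear,
    memLp_two_iff_integrable_sq (hmeas.comp_aemeasurable hshear),
    integrable_prod_iff (by exact (hmeas.comp_aemeasurable hshear).pow 2)]
  simp only [Function.comp_apply, gaussianScore_add, norm_pow, Real.norm_eq_abs, sq_abs]
  simp only [mul_pow]
  refine ⟨.of_forall fun ω => (memLp_reInner hσ (d ω)).integrable_sq.const_mul _, ?_⟩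
  simp only [integral_const_mul, integral_reInner_sq hσ]
  exact ((integrable_reInner hd hd).const_mul _).const_mul _

lemma integral_gaussianScore_mul_gaussianScore [SFinite P] (hm : AEMeasurable m P)
    (hd : MemLp d 2 P) (he : MemLp e 2 P) :
    ∫ z, gaussianScore σ m d z * gaussianScore σ m e z ∂gaussianChannel P σ m =
      2 / σ ^ 2 * ∫ ω, reInner (d ω) (e ω) ∂P := by
  have hint : Integrable (fun z => gaussianScore σ m d z * gaussianScore σ m e z)
      (gaussianChannel P σ m) :=
    (memLp_gaussianScore hσ hm hd).integrable_mul (memLp_gaussianScore hσ hm he)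
  rw [integral_gaussianChannel hm hint]
  simp only [gaussianScore_add, mul_mul_mul_comm (2 / σ ^ 2), integral_const_mul,
    integral_reInner_mul_reInner hσ]
  field_simp

lemma integral_mul_gaussianScore_of_unbiased {P : Measure Ω} [IsProbabilityMeasure P]
    (hm : AEMeasurable m P) (hd : MemLp d 2 P) {T : Ω × (ι → ℂ) → ℝ}
    (hT : MemLp T 2 (gaussianChannel P σ m)) {g : ℝ → ℝ} {g' : ℝ} (hg : HasDerivAt g g' 0)
    (hunb : ∀ᵐ ω ∂P, ∃ c : ℝ → ι → ℂ, c 0 = m ω ∧ HasDerivAt c (d ω) 0 ∧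
      ∀ᶠ t in 𝓝 0, ∫ w, T (ω, w + c t) ∂complexGaussian ι σ = g t) :
    ∫ z, T z * gaussianScore σ m d z ∂gaussianChannel P σ m = g' := by
  have hint : Integrable (fun z => T z * gaussianScore σ m d z) (gaussianChannel P σ m) :=
    hT.integrable_mul (memLp_gaussianScore hσ hm hd)
  rw [integral_gaussianChannel hm hint]
  simp only [gaussianScore_add]
  suffices h : ∀ᵐ ω ∂P, ∫ w, T (ω, w + m ω) * (2 / σ ^ 2 * reInner w (d ω))
      ∂complexGaussian ι σ = g' by
    rw [integral_congr_ae h, integral_const, probReal_univ, one_smul]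
  filter_upwards [ae_memLp_gaussianChannel_slice hm hT, hunb] with ω hTω ⟨c, hc0, hc, hexp⟩
  refine (hasDerivAt_integral_comp_add hσ hTω (by rw [hc0, sub_self])
    (hc.sub_const (m ω))).unique (hg.congr_of_eventuallyEq ?_)
  filter_upwards [hexp] with t ht
  simpa only [add_assoc, sub_add_cancel] using ht

end GaussianChannel

section CrossMoment

variable {𝕜 Ω m n l κ : Type*} [RCLike 𝕜] [MeasurableSpace Ω] [Fintype l] {P : Measure Ω}
  {X : Ω → Matrix m l 𝕜} {Y : Ω → Matrix n l 𝕜}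

/-- The matrix of cross moments `E[X Yᴴ]` of two random matrices, defined entrywise so that no norm
on matrices is involved. -/
noncomputable def crossMoment (P : Measure Ω) (X : Ω → Matrix m l 𝕜) (Y : Ω → Matrix n l 𝕜) :
    Matrix m n 𝕜 :=
  Matrix.of fun i j => ∑ t, ∫ ω, X ω i t * star (Y ω j t) ∂P

lemma conjTranspose_crossMoment (X : Ω → Matrix m l 𝕜) (Y : Ω → Matrix n l 𝕜) :
    (crossMoment P X Y)ᴴ = crossMoment P Y X := by
  ext i j
  simp only [crossMoment, conjTranspose_apply, of_apply, star_sum, RCLike.star_def, ← integral_conj,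
    map_mul, RCLike.conj_conj, mul_comm]

lemma integrable_mul_star {f g : Ω → 𝕜} (hf : MemLp f 2 P) (hg : MemLp g 2 P) :
    Integrable (fun ω => f ω * star (g ω)) P :=
  hf.integrable_mul hg.star

lemma crossMoment_mul_left [Fintype m] (A : Matrix κ m 𝕜)
    (hX : ∀ i t, MemLp (fun ω => X ω i t) 2 P) (hY : ∀ j t, MemLp (fun ω => Y ω j t) 2 P) :
    crossMoment P (fun ω => A * X ω) Y = A * crossMoment P X Y := by
  have hint : ∀ i k j t, Integrable (fun ω => A i k * (X ω k t * star (Y ω j t))) P :=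
    fun i k j t => (integrable_mul_star (hX k t) (hY j t)).const_mul _
  ext i j
  simp only [crossMoment, of_apply, mul_apply, Finset.sum_mul, mul_assoc,
    integral_finsetSum _ fun k _ => hint i k j _, integral_const_mul, Finset.mul_sum]
  exact Finset.sum_comm

lemma crossMoment_mul_right [Fintype n] (B : Matrix κ n 𝕜)
    (hX : ∀ i t, MemLp (fun ω => X ω i t) 2 P) (hY : ∀ j t, MemLp (fun ω => Y ω j t) 2 P) :
    crossMoment P X (fun ω => B * Y ω) = crossMoment P X Y * Bᴴ := by
  rw [← conjTranspose_crossMoment, crossMoment_mul_left B hY hX, conjTranspose_mul,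
    conjTranspose_crossMoment]

lemma crossMoment_sum_left {X : κ → Ω → Matrix m l 𝕜} (I : Finset κ)
    (hX : ∀ a i t, MemLp (fun ω => X a ω i t) 2 P) (hY : ∀ j t, MemLp (fun ω => Y ω j t) 2 P) :
    crossMoment P (fun ω => ∑ a ∈ I, X a ω) Y = ∑ a ∈ I, crossMoment P (X a) Y := by
  ext i j
  simp only [crossMoment, of_apply, Matrix.sum_apply, Finset.sum_mul,
    integral_finsetSum _ fun a _ => integrable_mul_star (hX a i _) (hY j _)]
  exact Finset.sum_comm

lemma crossMoment_sum_right {Y : κ → Ω → Matrix n l 𝕜} (I : Finset κ)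
    (hX : ∀ i t, MemLp (fun ω => X ω i t) 2 P) (hY : ∀ a j t, MemLp (fun ω => Y a ω j t) 2 P) :
    crossMoment P X (fun ω => ∑ a ∈ I, Y a ω) = ∑ a ∈ I, crossMoment P X (Y a) := by
  rw [← conjTranspose_crossMoment, crossMoment_sum_left I hY hX, conjTranspose_sum]
  simp only [conjTranspose_crossMoment]

omit [Fintype l] in
lemma memLp_mul_apply [Fintype m] (A : Matrix κ m 𝕜) (hX : ∀ i t, MemLp (fun ω => X ω i t) 2 P)
    (i : κ) (t : l) : MemLp (fun ω => (A * X ω) i t) 2 P := by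
  simp only [mul_apply]
  exact memLp_finsetSum _ fun k _ => (hX k t).const_mul _

lemma integral_reInner_vec [Fintype m] {X Y : Ω → Matrix m l ℂ}
    (hX : ∀ i t, MemLp (fun ω => X ω i t) 2 P) (hY : ∀ i t, MemLp (fun ω => Y ω i t) 2 P) :
    ∫ ω, reInner (vec (X ω)) (vec (Y ω)) ∂P = (crossMoment P Y X).trace.re := by
  have hint : ∀ i t, Integrable (fun ω => Y ω i t * star (X ω i t)) P := fun i t =>
    integrable_mul_star (hY i t) (hX i t)
  have hint_re : ∀ i t, Integrable (fun ω => (Y ω i t * star (X ω i t)).re) P := fun i t =>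
    (hint i t).re
  have hre : ∀ i t, ∫ ω, (Y ω i t * star (X ω i t)).re ∂P =
      (∫ ω, Y ω i t * star (X ω i t) ∂P).re := fun i t => integral_re (hint i t)
  have hexpand : ∀ ω, reInner (vec (X ω)) (vec (Y ω)) =
      ∑ i, ∑ t, (Y ω i t * star (X ω i t)).re := fun ω => by
    rw [reInner_apply, Fintype.sum_prod_type_right]
    simp only [vec, Complex.inner, Complex.star_def]
  simp only [hexpand, trace, diag_apply, crossMoment, of_apply, Complex.re_sum, ← hre]
  rw [integral_finsetSum _ fun i _ => integrable_finsetSum _ fun t _ => hint_re i t]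
  exact Finset.sum_congr rfl fun i _ => integral_finsetSum _ fun t _ => hint_re i t

end CrossMoment

section SecondMoment

variable {Ω ι : Type*} [MeasurableSpace Ω] {μ : Measure Ω} {X : ι → Ω → ℝ}

/-- The matrix of the second moments `E[Xᵢ Xⱼ]` of a family of random variables. -/
noncomputable def secondMoment (μ : Measure Ω) (X : ι → Ω → ℝ) : Matrix ι ι ℝ :=
  of fun i j => ∫ ω, X i ω * X j ω ∂μ

lemma isSymm_secondMoment (μ : Measure Ω) (X : ι → Ω → ℝ) : (secondMoment μ X).IsSymm :=
  Matrix.ext fun i j => by simp only [secondMoment, transpose_apply, of_apply, mul_comm]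

lemma secondMoment_eq_gram (hX : ∀ i, MemLp (X i) 2 μ) :
    secondMoment μ X = gram ℝ fun i => (hX i).toLp (X i) :=
  Matrix.ext fun i j => (inner_toLp (hX i) (hX j)).symm

lemma posSemidef_secondMoment [Finite ι] (hX : ∀ i, MemLp (X i) 2 μ) :
    (secondMoment μ X).PosSemidef := by
  rw [secondMoment_eq_gram hX]
  exact posSemidef_gram ℝ _

lemma inv_secondMoment_apply_le [Fintype ι] [DecidableEq ι] (hX : ∀ i, MemLp (X i) 2 μ)
    (hdet : IsUnit (secondMoment μ X).det) {U : Ω → ℝ} (hU : MemLp U 2 μ) {k : ι}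
    (hUX : ∀ i, ∫ ω, U ω * X i ω ∂μ = if i = k then 1 else 0) :
    (secondMoment μ X)⁻¹ k k ≤ ∫ ω, U ω ^ 2 ∂μ := by
  rw [secondMoment_eq_gram hX] at hdet ⊢
  have hcov : (fun i => inner ℝ ((hX i).toLp (X i)) (hU.toLp U)) = Pi.single k 1 := by
    ext i
    rw [real_inner_comm, inner_toLp, hUX, Pi.single_apply]
  have hnorm : ‖hU.toLp U‖ ^ 2 = ∫ ω, U ω ^ 2 ∂μ := by
    rw [← real_inner_self_eq_norm_sq, inner_toLp]
    simp only [sq]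
  have hle := re_dotProduct_inv_gram_mulVec_le hdet (hU.toLp U)
  rw [hcov, hnorm] at hle
  simpa using hle

end SecondMoment

namespace IsacNetwork

variable {S K N L : ℕ} {Ω : Type*} (M : IsacNetwork S K N L Ω)

section Geometry

variable {p : Plane} (s s' : Fin S)

lemma differentiableAt_sin_angle (hp : p ≠ M.pos s) :
    DifferentiableAt ℝ (fun q => Real.sin (M.angle s q)) p := by
  let z : Plane → ℂ := fun q => (⟨q 0 - M.pos s 0, q 1 - M.pos s 1⟩ : ℂ) *
    Complex.exp (-Complex.I * (M.boresight s : ℂ))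
  have hz : z p ≠ 0 := by
    refine mul_ne_zero (fun h => hp ?_) (Complex.exp_ne_zero _)
    obtain ⟨h₀, h₁⟩ := Complex.ext_iff.1 h
    ext i
    fin_cases i
    exacts [sub_eq_zero.1 h₀, sub_eq_zero.1 h₁]
  have hdiff : DifferentiableAt ℝ z p := by
    simp only [z, Complex.mk_eq_add_mul_I, Complex.ofReal_sub]
    fun_prop
  have hsin : (fun q => Real.sin (M.angle s q)) = fun q => (z q).im / ‖z q‖ :=
    funext fun q => Complex.sin_arg _
  rw [hsin]
  simp only [div_eq_mul_inv]
  exact (Complex.imCLM.differentiableAt.comp p hdiff).mul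
    ((hdiff.norm ℝ hz).inv (norm_ne_zero_iff.2 hz))

lemma differentiableAt_steering_angle (hp : p ≠ M.pos s) :
    DifferentiableAt ℝ (fun q => steering N (M.angle s q)) p :=
  differentiableAt_pi.2 fun _ =>
    ((Complex.ofRealCLM.differentiableAt.comp p (M.differentiableAt_sin_angle s hp)).const_mul
      _).cexp

lemma hasLineDerivAt_steering_angle (hp : p ≠ M.pos s) (i : Fin 2) :
    HasLineDerivAt ℝ (fun q => steering N (M.angle s q)) (M.steeringDeriv s p i) p
      (EuclideanSpace.single i 1) :=
  (M.differentiableAt_steering_angle s hp).lineDifferentiableAt.hasLineDerivAt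

lemma differentiableAt_delay (hp : p ≠ M.pos s) (hp' : p ≠ M.pos s') :
    DifferentiableAt ℝ (M.delay s s') p := by
  have hdist (r : Fin S) (hr : p ≠ M.pos r) : DifferentiableAt ℝ (fun q => ‖q - M.pos r‖) p :=
    (differentiableAt_id.sub_const _).norm ℝ (sub_ne_zero.2 hr)
  unfold delay
  simp only [div_eq_mul_inv]
  exact ((hdist s' hp').fun_add (hdist s hp)).mul_const _

lemma differentiableAt_response (hp : p ≠ M.pos s) (hp' : p ≠ M.pos s') (a b : Fin N) :
    DifferentiableAt ℝ (fun q => M.response s s' q a b) p :=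
  (differentiableAt_pi.1 (M.differentiableAt_steering_angle s hp) a).mul
    (differentiableAt_pi.1 (M.differentiableAt_steering_angle s' hp') b).star

lemma hasLineDerivAt_response (hp : p ≠ M.pos s) (hp' : p ≠ M.pos s') (i : Fin 2) (a b : Fin N) :
    HasLineDerivAt ℝ (fun q => M.response s s' q a b) (M.responseDeriv s s' p i a b) p
      (EuclideanSpace.single i 1) := by
  have hreceive := hasDerivAt_pi.1 (M.hasLineDerivAt_steering_angle (N := N) s hp i) a
  have htransmit := hasDerivAt_pi.1 (M.hasLineDerivAt_steering_angle (N := N) s' hp' i) b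
  have hmul := hreceive.fun_mul htransmit.star
  rw [zero_smul, add_zero] at hmul
  exact hmul

end Geometry

section Signals

/-- The communication signals and the components of the sensing signal of `s'`, at time `t`. -/
def signal (s' : Fin S) (ω : Ω) (t : ℝ) : Fin K ⊕ Fin N → ℂ :=
  Sum.elim (fun k => M.sym s' k t ω) (M.sens s' t ω)

/-- The matrix which maps the signals of `s'` to the waveform that `s'` transmits. -/
def precoder (s' : Fin S) : Matrix (Fin N) (Fin K ⊕ Fin N) ℂ :=
  fromCols (of fun n k => (if M.assoc s' k then 1 else 0) * M.beam s' k n) 1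

lemma transmit_eq_precoder_mulVec {s : Fin S} (s' : Tx s) (ω : Ω) (t : ℝ) :
    M.transmit s s' ω t = M.precoder s' *ᵥ M.signal s' ω t := by
  rw [precoder, fromCols_mulVec, one_mulVec, transmit, select, if_neg s'.2, one_smul]
  congr 1
  ext n
  simp only [mulVec, dotProduct, signal, of_apply, Finset.sum_apply, Pi.smul_apply, smul_eq_mul,
    Function.comp_apply, Sum.elim_inl, mul_right_comm]

/-- The signals of `s'` at the delayed sampling instants. -/
noncomputable def sampled (s s' : Fin S) (ω : Ω) (p : Plane) : Matrix (Fin K ⊕ Fin N) (Fin L) ℂ :=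
  of fun j l => M.signal s' ω (M.instant s s' p l) j

/-- The derivative of `sampled` in the `i`-th coordinate of the target, by the chain rule. -/
noncomputable def sampledDeriv (s s' : Fin S) (ω : Ω) (p : Plane) (i : Fin 2) :
    Matrix (Fin K ⊕ Fin N) (Fin L) ℂ :=
  of fun j l => -M.delayDeriv s s' p i • deriv (fun t => M.signal s' ω t j) (M.instant s s' p l)

lemma delayed_eq_precoder_mul_sampled {s : Fin S} (s' : Tx s) (ω : Ω) (p : Plane) :
    M.delayed s s' ω p = M.precoder s' * M.sampled s s' ω p := by
  ext n l
  exact congrFun (M.transmit_eq_precoder_mulVec s' ω _) n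

/-- The signals with outcome `ω` are differentiable at the sampling instants. -/
def SmoothSignals (s : Fin S) (p : Plane) (ω : Ω) : Prop :=
  ∀ (s' : Tx s) (j : Fin K ⊕ Fin N) (l : Fin L),
    DifferentiableAt ℝ (fun t => M.signal s' ω t j) (M.instant s s' p l)

variable {M} {s : Fin S} {p : Plane} {ω : Ω} (hω : M.SmoothSignals s p ω)
  (hp : ∀ r, p ≠ M.pos r) (s' : Tx s)
include hω hp

lemma SmoothSignals.differentiableAt_sampled (j : Fin K ⊕ Fin N) (l : Fin L) :
    DifferentiableAt ℝ (fun q => M.sampled s s' ω q j l) p :=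
  have hinstant : DifferentiableAt ℝ (fun q => M.instant s s' q l) p :=
    (M.differentiableAt_delay s s' (hp s) (hp s')).const_sub _
  DifferentiableAt.comp (g := fun t => M.signal s' ω t j) p (hω s' j l) hinstant

lemma SmoothSignals.hasLineDerivAt_sampled (i : Fin 2) (j : Fin K ⊕ Fin N) (l : Fin L) :
    HasLineDerivAt ℝ (fun q => M.sampled s s' ω q j l) (M.sampledDeriv s s' ω p i j l) p
      (EuclideanSpace.single i 1) := by
  have hinstant : HasLineDerivAt ℝ (fun q => M.instant s s' q l) (-M.delayDeriv s s' p i) p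
      (EuclideanSpace.single i 1) :=
    ((M.differentiableAt_delay s s' (hp s)
      (hp s')).lineDifferentiableAt.hasLineDerivAt).const_sub _
  refine HasDerivAt.scomp_of_eq (0 : ℝ) (hω s' j l).hasDerivAt hinstant ?_
  rw [zero_smul, add_zero]

lemma SmoothSignals.differentiableAt_delayed (n : Fin N) (l : Fin L) :
    DifferentiableAt ℝ (fun q => M.delayed s s' ω q n l) p := by
  simp only [delayed_eq_precoder_mul_sampled, mul_apply]
  exact .fun_sum fun j _ => (hω.differentiableAt_sampled hp s' j l).const_mul _

lemma SmoothSignals.hasLineDerivAt_delayed (i : Fin 2) (n : Fin N) (l : Fin L) :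
    HasLineDerivAt ℝ (fun q => M.delayed s s' ω q n l)
      ((M.precoder s' * M.sampledDeriv s s' ω p i) n l) p (EuclideanSpace.single i 1) := by
  simp only [delayed_eq_precoder_mul_sampled, mul_apply]
  exact HasDerivAt.fun_sum fun j _ => (hω.hasLineDerivAt_sampled hp s' i j l).const_mul _

end Signals

section MeanEcho

/-- The noise-free echo of the link from `s'` via the target at `p` to `s`, for unit gain. -/
noncomputable def echo (s s' : Fin S) (ω : Ω) (p : Plane) : Obs N L :=
  vec (M.response s s' p * M.delayed s s' ω p)

/-- The derivative of `echo` in the `i`-th coordinate of the target, by the product rule. -/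
noncomputable def echoDeriv (s s' : Fin S) (ω : Ω) (p : Plane) (i : Fin 2) : Obs N L :=
  vec (M.responseDeriv s s' p i * M.delayed s s' ω p +
    M.response s s' p * (M.precoder s' * M.sampledDeriv s s' ω p i))

/-- The derivative of `meanEcho` in the `i`-th unknown. -/
noncomputable def meanDeriv (s : Fin S) (ξ : Param s) (ω : Ω) (i : Idx s) : Obs N L :=
  ∑ s' : Tx s, (gain ξ s' • Sum.elim (M.echoDeriv s s' ω (target ξ)) 0 i +
    gain (Pi.single i 1) s' • M.echo s s' ω (target ξ))

variable {s : Fin S}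

lemma target_single_inl (i : Fin 2) :
    target (Pi.single (Sum.inl i) 1 : Param s) = EuclideanSpace.single i 1 := by
  ext j
  simp [target, Pi.single_apply]

lemma target_single_inr (r : Tx s ⊕ Tx s) : target (Pi.single (Sum.inr r) 1 : Param s) = 0 := by
  ext j
  simp [target]

lemma differentiable_target : Differentiable ℝ (target : Param s → Plane) :=
  fun ξ => (differentiableAt_piLp 2).2 fun i => differentiableAt_apply (Sum.inl i) ξ

lemma gain_add_smul (ξ η : Param s) (t : ℝ) (s' : Tx s) :
    gain (ξ + t • η) s' = gain ξ s' + t • gain η s' :=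
  Complex.ext (by simp [gain]) (by simp [gain])

lemma gain_single_inl (i : Fin 2) (s' : Tx s) :
    gain (Pi.single (Sum.inl i) 1 : Param s) s' = 0 :=
  Complex.ext (by simp [gain]) (by simp [gain])

lemma gain_single_inr_inl (r s' : Tx s) :
    gain (Pi.single (Sum.inr (Sum.inl r)) 1 : Param s) s' = if s' = r then 1 else 0 := by
  apply Complex.ext <;> by_cases h : s' = r <;> simp [gain, h]

lemma gain_single_inr_inr (r s' : Tx s) :
    gain (Pi.single (Sum.inr (Sum.inr r)) 1 : Param s) s' = if s' = r then Complex.I else 0 := by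
  apply Complex.ext <;> by_cases h : s' = r <;> simp [gain, h]

lemma differentiable_gain (s' : Tx s) : Differentiable ℝ fun ξ : Param s => gain ξ s' := by
  simp only [gain, Complex.mk_eq_add_mul_I]
  fun_prop

variable {M} {p : Plane} {ω : Ω} (s' : Tx s)

lemma SmoothSignals.differentiableAt_echo (hω : M.SmoothSignals s p ω) (hp : ∀ r, p ≠ M.pos r) :
    DifferentiableAt ℝ (M.echo s s' ω) p :=
  differentiableAt_pi.2 fun m => .fun_sum (u := Finset.univ) fun b _ =>
    (M.differentiableAt_response s s' (hp s) (hp s') m.2 b).fun_mul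
      (hω.differentiableAt_delayed hp s' b m.1)

lemma SmoothSignals.hasLineDerivAt_echo (hω : M.SmoothSignals s p ω) (hp : ∀ r, p ≠ M.pos r)
    (i : Fin 2) :
    HasLineDerivAt ℝ (M.echo s s' ω) (M.echoDeriv s s' ω p i) p (EuclideanSpace.single i 1) := by
  refine hasDerivAt_pi.2 fun m => ?_
  have hsum := HasDerivAt.fun_sum (u := Finset.univ) fun b _ => HasDerivAt.fun_mul
    (M.hasLineDerivAt_response s s' (hp s) (hp s') i m.2 b)
    (hω.hasLineDerivAt_delayed hp s' i b m.1)
  refine HasDerivAt.congr_deriv hsum ?_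
  simp only [zero_smul, add_zero, Finset.sum_add_distrib]
  rfl

variable {ξ : Param s} (hω : M.SmoothSignals s (target ξ) ω) (hpos : ∀ r, target ξ ≠ M.pos r)
include hω hpos

lemma SmoothSignals.differentiableAt_meanEcho :
    DifferentiableAt ℝ (fun η => M.meanEcho s η ω) ξ :=
  .fun_sum fun s' _ => (differentiable_gain s' ξ).smul
    ((hω.differentiableAt_echo s' hpos).comp ξ (differentiable_target ξ))

lemma SmoothSignals.hasLineDerivAt_meanEcho (i : Idx s) :
    HasLineDerivAt ℝ (fun η => M.meanEcho s η ω) (M.meanDeriv s ξ ω i) ξ (Pi.single i 1) := by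
  refine HasDerivAt.fun_sum fun s' _ => ?_
  have hgain : HasDerivAt (fun t : ℝ => gain (ξ + t • Pi.single i 1) s')
      (gain (Pi.single i 1) s') 0 := by
    simpa only [gain_add_smul, id_eq, one_smul] using
      ((hasDerivAt_id (0 : ℝ)).smul_const (gain (Pi.single i 1) s')).const_add (gain ξ s')
  have hecho : HasLineDerivAt ℝ (M.echo s s' ω) (Sum.elim (M.echoDeriv s s' ω (target ξ)) 0 i)
      (target ξ) (target (Pi.single i 1)) := by
    rcases i with i | r
    · rw [target_single_inl]
      exact hω.hasLineDerivAt_echo s' hpos i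
    · rw [target_single_inr]
      exact hasLineDerivAt_zero
  have hsmul := HasDerivAt.fun_smul hgain hecho
  rw [zero_smul, zero_smul, add_zero, add_zero] at hsmul
  exact hsmul

end MeanEcho

variable {M} {s : Fin S} {ξ : Param s}

section Likelihood

variable (M s ξ) in
lemma density_eq_complexGaussianPDF (ω : Ω) (y : Obs N L) :
    M.density s ξ ω y = complexGaussianPDF (M.noise s) (y - M.meanEcho s ξ ω) := by
  simp only [density, complexGaussianPDF, reInner_self, Pi.sub_apply, Fintype.card_prod,
    Fintype.card_fin, mul_comm N L]

variable (M s ξ) in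
lemma condLaw_eq_map (ω : Ω) :
    M.condLaw s ξ ω =
      (complexGaussian (Fin L × Fin N) (M.noise s)).map (· + M.meanEcho s ξ ω) := by
  simp only [condLaw, density_eq_complexGaussianPDF, map_add_right_complexGaussian]

variable {z : Ω × Obs N L} (hz : M.SmoothSignals s (target ξ) z.1)
  (hpos : ∀ r, target ξ ≠ M.pos r)
include hz hpos

lemma differentiableAt_logLik : DifferentiableAt ℝ (M.logLik s z) ξ := by
  have hσ := M.noise_pos s
  have := Real.pi_pos
  have hdensity : DifferentiableAt ℝ (fun η => M.density s η z.1 z.2) ξ := by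
    have hmean := differentiableAt_pi.1 (hz.differentiableAt_meanEcho hpos)
    simp only [density, div_eq_mul_inv]
    exact ((DifferentiableAt.fun_sum fun m _ =>
      ((hmean m).const_sub (z.2 m)).norm_sq ℝ).fun_neg.mul_const _).exp.const_mul _
  refine hdensity.log ?_
  rw [density]
  positivity

lemma score_eq_gaussianScore (i : Idx s) :
    M.score s ξ i z =
      gaussianScore (M.noise s) (M.meanEcho s ξ) (fun ω => M.meanDeriv s ξ ω i) z := by
  have hlog := hasDerivAt_log_complexGaussianPDF_sub (M.noise_pos s).ne' z.2
    (hz.hasLineDerivAt_meanEcho hpos i)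
  rw [zero_smul, add_zero] at hlog
  refine HasLineDerivAt.lineDeriv (hlog.congr_of_eventuallyEq (.of_forall fun t => ?_))
  simp only [logLik, density_eq_complexGaussianPDF]

end Likelihood

section Regularity

variable [MeasurableSpace Ω] {P : Measure Ω}

section Signals

variable {p : Plane} (hreg : M.RegularSignals P s p)
include hreg

lemma RegularSignals.ae_smoothSignals : ∀ᵐ ω ∂P, M.SmoothSignals s p ω := by
  simp only [SmoothSignals, ae_all_iff]
  rintro s' (k | n) l
  exacts [hreg.sym_diff s' k l, hreg.sens_diff s' n l]

lemma RegularSignals.memLp_sampled (s' : Tx s) (j : Fin K ⊕ Fin N) (l : Fin L) :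
    MemLp (fun ω => M.sampled s s' ω p j l) 2 P := by
  rcases j with k | n
  exacts [hreg.sym_memLp s' k l, hreg.sens_memLp s' n l]

lemma RegularSignals.memLp_sampledDeriv (s' : Tx s) (i : Fin 2) (j : Fin K ⊕ Fin N) (l : Fin L) :
    MemLp (fun ω => M.sampledDeriv s s' ω p i j l) 2 P := by
  refine MemLp.const_smul ?_ _
  rcases j with k | n
  exacts [hreg.sym_deriv_memLp s' k l, hreg.sens_deriv_memLp s' n l]

lemma RegularSignals.memLp_delayed (s' : Tx s) (n : Fin N) (l : Fin L) :
    MemLp (fun ω => M.delayed s s' ω p n l) 2 P := by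
  simp only [delayed_eq_precoder_mul_sampled]
  exact memLp_mul_apply _ (hreg.memLp_sampled s') n l

lemma RegularSignals.memLp_echo (s' : Tx s) : MemLp (fun ω => M.echo s s' ω p) 2 P :=
  MemLp.of_eval fun m => memLp_mul_apply _ (hreg.memLp_delayed s') m.2 m.1

lemma RegularSignals.memLp_echoDeriv (s' : Tx s) (i : Fin 2) :
    MemLp (fun ω => M.echoDeriv s s' ω p i) 2 P :=
  MemLp.of_eval fun m => (memLp_mul_apply _ (hreg.memLp_delayed s') m.2 m.1).add
    (memLp_mul_apply _ (memLp_mul_apply _ (hreg.memLp_sampledDeriv s' i)) m.2 m.1)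

end Signals

variable (hreg : M.RegularSignals P s (target ξ))
include hreg

lemma RegularSignals.memLp_meanEcho : MemLp (M.meanEcho s ξ) 2 P :=
  memLp_finsetSum _ fun s' _ => (hreg.memLp_echo s').const_smul (gain ξ s')

lemma RegularSignals.memLp_meanDeriv (i : Idx s) : MemLp (fun ω => M.meanDeriv s ξ ω i) 2 P := by
  have hposition (s' : Tx s) :
      MemLp (fun ω => Sum.elim (M.echoDeriv s s' ω (target ξ)) 0 i) 2 P := by
    rcases i with i | _
    exacts [hreg.memLp_echoDeriv s' i, MemLp.zero]
  exact memLp_finsetSum _ fun s' _ =>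
    ((hposition s').const_smul (gain ξ s')).add
      ((hreg.memLp_echo s').const_smul (gain (Pi.single i 1) s'))

lemma RegularSignals.law_eq_gaussianChannel :
    M.law P s ξ = gaussianChannel P (M.noise s) (M.meanEcho s ξ) := by
  rw [← withDensity_complexGaussianPDF_sub hreg.memLp_meanEcho.1.aemeasurable, law]
  simp only [density_eq_complexGaussianPDF]

lemma RegularSignals.isProbabilityMeasure_law [IsProbabilityMeasure P] :
    IsProbabilityMeasure (M.law P s ξ) := by
  rw [hreg.law_eq_gaussianChannel]
  exact isProbabilityMeasure_gaussianChannel (M.noise_pos s).ne' hreg.memLp_meanEcho.1.aemeasurable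

lemma RegularSignals.ae_law_smoothSignals :
    ∀ᵐ z ∂M.law P s ξ, M.SmoothSignals s (target ξ) z.1 := by
  rw [hreg.law_eq_gaussianChannel]
  exact (quasiMeasurePreserving_fst_gaussianChannel hreg.memLp_meanEcho.1.aemeasurable).ae
    hreg.ae_smoothSignals

variable (hpos : ∀ r, target ξ ≠ M.pos r)
include hpos

lemma RegularSignals.score_ae_eq_gaussianScore (i : Idx s) :
    M.score s ξ i =ᵐ[M.law P s ξ]
      gaussianScore (M.noise s) (M.meanEcho s ξ) fun ω => M.meanDeriv s ξ ω i := by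
  filter_upwards [hreg.ae_law_smoothSignals] with z hz
  exact score_eq_gaussianScore hz hpos i

lemma RegularSignals.memLp_score (i : Idx s) : MemLp (M.score s ξ i) 2 (M.law P s ξ) := by
  rw [memLp_congr_ae (hreg.score_ae_eq_gaussianScore hpos i), hreg.law_eq_gaussianChannel]
  exact memLp_gaussianScore (M.noise_pos s).ne' hreg.memLp_meanEcho.1.aemeasurable
    (hreg.memLp_meanDeriv i)

lemma RegularSignals.fisher_apply [SFinite P] (i j : Idx s) :
    M.fisher P s ξ i j =
      2 / M.noise s ^ 2 * ∫ ω, reInner (M.meanDeriv s ξ ω i) (M.meanDeriv s ξ ω j) ∂P := by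
  have hscore (i : Idx s) := hreg.score_ae_eq_gaussianScore hpos i
  refine (integral_congr_ae ((hscore i).mul (hscore j))).trans ?_
  rw [hreg.law_eq_gaussianChannel]
  exact integral_gaussianScore_mul_gaussianScore (M.noise_pos s).ne'
    hreg.memLp_meanEcho.1.aemeasurable (hreg.memLp_meanDeriv i) (hreg.memLp_meanDeriv j)

end Regularity

section CramerRao

lemma target_add_smul_single_apply (ξ : Param s) (i : Idx s) (t : ℝ) (k : Fin 2) :
    target (ξ + t • Pi.single i 1) k = target ξ k + t * if i = Sum.inl k then 1 else 0 := by
  simp only [target, Pi.add_apply, Pi.smul_apply, Pi.single_apply, smul_eq_mul, eq_comm]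

lemma integral_comp_add_meanEcho_apply_sub {η : Param s} {ω : Ω} {T : Obs N L → Plane}
    (hT : Measurable T) (hint : Integrable T (M.condLaw s η ω))
    (hexp : ∫ y, T y ∂M.condLaw s η ω = target η) (a : ℝ) (k : Fin 2) :
    ∫ w, (T (w + M.meanEcho s η ω) k - a) ∂complexGaussian (Fin L × Fin N) (M.noise s) =
      target η k - a := by
  have := isProbabilityMeasure_complexGaussian (ι := Fin L × Fin N) (M.noise_pos s).ne'
  have hshift : AEMeasurable (· + M.meanEcho s η ω)
      (complexGaussian (Fin L × Fin N) (M.noise s)) :=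
    (measurable_add_const _).aemeasurable
  rw [condLaw_eq_map] at hint hexp
  rw [integral_map hshift hT.aestronglyMeasurable] at hexp
  replace hint := hint.comp_aemeasurable hshift
  have hproj := (EuclideanSpace.proj k : Plane →L[ℝ] ℝ).integral_comp_comm hint
  have hintk : Integrable (fun w => T (w + M.meanEcho s η ω) k) _ :=
    (EuclideanSpace.proj k : Plane →L[ℝ] ℝ).integrable_comp hint
  rw [integral_sub hintk (integrable_const a), integral_const, probReal_univ, one_smul, ← hexp]
  exact congrArg (· - a) hproj

variable [MeasurableSpace Ω] {P : Measure Ω} [IsProbabilityMeasure P]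
  (hreg : M.RegularSignals P s (target ξ))
  (hpos : ∀ r, target ξ ≠ M.pos r) {T : Ω × Obs N L → Plane} (hT : M.IsUnbiased P s ξ T)
include hreg hpos hT

lemma IsUnbiased.integral_sub_mul_score {k : Fin 2}
    (hk : MemLp (fun z => T z k - target ξ k) 2 (M.law P s ξ)) (i : Idx s) :
    ∫ z, (T z k - target ξ k) * M.score s ξ i z ∂M.law P s ξ = if i = Sum.inl k then 1 else 0 := by
  have hscore := hreg.score_ae_eq_gaussianScore hpos i
  refine (integral_congr_ae (hscore.mono fun z hz => congrArg _ hz)).trans ?_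
  rw [hreg.law_eq_gaussianChannel] at hk ⊢
  have hline : Filter.Tendsto (fun t : ℝ => ξ + t • (Pi.single i 1 : Param s)) (𝓝 0) (𝓝 ξ) :=
    Continuous.tendsto' (by fun_prop) 0 ξ (by rw [zero_smul, add_zero])
  refine integral_mul_gaussianScore_of_unbiased (M.noise_pos s).ne'
    hreg.memLp_meanEcho.1.aemeasurable (hreg.memLp_meanDeriv i) hk (hasDerivAt_mul_const _) ?_
  filter_upwards [hreg.ae_smoothSignals, hT.2] with ω hω hunb
  refine ⟨fun t => M.meanEcho s (ξ + t • Pi.single i 1) ω, by simp only [zero_smul, add_zero],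
    hω.hasLineDerivAt_meanEcho hpos i, ?_⟩
  filter_upwards [hline.eventually hunb] with t ⟨hint, hexp⟩
  have hbias := integral_comp_add_meanEcho_apply_sub (hT.1.comp measurable_prodMk_left) hint hexp
    (target ξ k) k
  rwa [target_add_smul_single_apply, add_sub_cancel_left] at hbias

lemma IsUnbiased.crlb_le_integral (hdet : IsUnit (M.fisher P s ξ).det)
    (herr : MemLp (fun z => T z - target ξ) 2 (M.law P s ξ)) :
    M.crlb P s ξ ≤ ∫ z, ‖T z - target ξ‖ ^ 2 ∂M.law P s ξ := by
  have hcoord (k : Fin 2) : MemLp (fun z => T z k - target ξ k) 2 (M.law P s ξ) :=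
    (EuclideanSpace.proj k : Plane →L[ℝ] ℝ).comp_memLp' herr
  have hsum : ∫ z, ‖T z - target ξ‖ ^ 2 ∂M.law P s ξ =
      ∑ k, ∫ z, (T z k - target ξ k) ^ 2 ∂M.law P s ξ := by
    rw [← integral_finsetSum _ fun k _ => (hcoord k).integrable_sq]
    simp only [EuclideanSpace.norm_sq_eq, PiLp.sub_apply, Real.norm_eq_abs, sq_abs]
  rw [hsum, crlb, trace]
  exact Finset.sum_le_sum fun k _ => inv_secondMoment_apply_le (hreg.memLp_score hpos) hdet
    (hcoord k) (hT.integral_sub_mul_score hreg hpos (hcoord k))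

lemma IsUnbiased.ofReal_crlb_le_lintegral (hdet : IsUnit (M.fisher P s ξ).det) :
    ENNReal.ofReal (M.crlb P s ξ) ≤ ∫⁻ z, ‖T z - target ξ‖ₑ ^ 2 ∂M.law P s ξ := by
  by_cases htop : ∫⁻ z, ‖T z - target ξ‖ₑ ^ 2 ∂M.law P s ξ = ⊤
  · rw [htop]
    exact le_top
  have herr : MemLp (fun z => T z - target ξ) 2 (M.law P s ξ) := by
    refine ⟨(hT.1.sub_const _).aestronglyMeasurable, ?_⟩
    rw [eLpNorm_lt_top_iff_lintegral_rpow_enorm_lt_top two_ne_zero ENNReal.ofNat_ne_top]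
    simpa using Ne.lt_top htop
  refine (ENNReal.ofReal_le_ofReal (hT.crlb_le_integral hreg hpos hdet herr)).trans_eq ?_
  rw [ofReal_integral_eq_lintegral_ofReal herr.norm.integrable_sq
    (ae_of_all _ fun z => sq_nonneg _)]
  simp only [ENNReal.ofReal_pow (norm_nonneg _), ofReal_norm]

end CramerRao

section Coefficients

variable (M) in
/-- The matrix by which the delayed signals of `s'` enter the derivative of `meanEcho` in the `i`-th
unknown, under the convention `DelayConvention`. -/
noncomputable def coeffMatrix (s : Fin S) (ξ : Param s) (i : Idx s) (s' : Tx s) :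
    Matrix (Fin N) (Fin N) ℂ :=
  gain ξ s' • Sum.elim (M.responseTilde s s' (target ξ)) 0 i +
    gain (Pi.single i 1) s' • M.response s s' (target ξ)

lemma coeffMatrix_inl (i : Fin 2) (s' : Tx s) :
    M.coeffMatrix s ξ (Sum.inl i) s' = gain ξ s' • M.responseTilde s s' (target ξ) i := by
  rw [coeffMatrix, gain_single_inl, zero_smul, add_zero, Sum.elim_inl]

lemma coeffMatrix_inr (r : Tx s ⊕ Tx s) (s' : Tx s) :
    M.coeffMatrix s ξ (Sum.inr r) s' =
      gain (Pi.single (Sum.inr r) 1) s' • M.response s s' (target ξ) := by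
  rw [coeffMatrix, Sum.elim_inr, Pi.zero_apply, smul_zero, zero_add]

end Coefficients

variable [MeasurableSpace Ω] {P : Measure Ω}

section Covariance

variable {p : Plane}

lemma sensCov_eq_smul_crossMoment (s' : Fin S) :
    M.sensCov P s' = (L : ℂ)⁻¹ • crossMoment P
      (fun ω => of fun n (l : Fin L) => M.sens s' ((l : ℝ) + 1) ω n)
      (fun ω => of fun n (l : Fin L) => M.sens s' ((l : ℝ) + 1) ω n) := rfl

lemma isHermitian_sensCov (s' : Fin S) : (M.sensCov P s').IsHermitian := by
  rw [IsHermitian, sensCov_eq_smul_crossMoment, conjTranspose_smul, conjTranspose_crossMoment,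
    star_inv₀, star_natCast]

variable (M P) in
/-- The covariance matrix of the communication and sensing signals of `s'`, in the order of
`signal`. -/
noncomputable def signalCov (s' : Fin S) : Matrix (Fin K ⊕ Fin N) (Fin K ⊕ Fin N) ℂ :=
  fromBlocks 1 0 0 (M.sensCov P s')

lemma precoder_mul_signalCov_mul_conjTranspose (s' : Fin S) :
    M.precoder s' * M.signalCov P s' * (M.precoder s')ᴴ = M.txCov P s' := by
  rw [precoder, signalCov, fromCols_mul_fromBlocks,
    conjTranspose_fromCols_eq_fromRows_conjTranspose, fromCols_mul_fromRows]
  simp only [Matrix.mul_one, Matrix.mul_zero, add_zero, zero_add, Matrix.one_mul,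
    conjTranspose_one, txCov]
  congr 1
  ext m n
  simp only [mul_apply, of_apply, conjTranspose_apply, Matrix.sum_apply, Matrix.smul_apply,
    vecMulVec_apply, Pi.star_apply, smul_eq_mul]
  refine Finset.sum_congr rfl fun k _ => ?_
  split_ifs <;> simp

lemma isHermitian_txCov (s' : Fin S) : (M.txCov P s').IsHermitian := by
  rw [← precoder_mul_signalCov_mul_conjTranspose]
  exact isHermitian_mul_mul_conjTranspose _
    (isHermitian_one.fromBlocks conjTranspose_zero (isHermitian_sensCov s'))

lemma im_trace_response_mul_txCov (s' : Fin S) (p : Plane) :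
    (M.response s s' p * M.txCov P s' * (M.response s s' p)ᴴ).trace.im = 0 := by
  rw [← Complex.conj_eq_iff_im, ← Complex.star_def, ← trace_conjTranspose]
  exact congrArg trace (isHermitian_mul_mul_conjTranspose _ (isHermitian_txCov s'))

lemma eq_natCast_mul_of_inv_mul_sum_eq {f : Fin L → ℂ} {c : ℂ} (h : (L : ℂ)⁻¹ * ∑ l, f l = c) :
    ∑ l, f l = L * c := by
  rcases eq_or_ne L 0 with rfl | hL
  · rw [Fin.sum_univ_zero, Nat.cast_zero, zero_mul]
  · rw [← h, mul_inv_cancel_left₀ (Nat.cast_ne_zero.2 hL)]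

lemma SignalStatistics.crossMoment_sampled (hst : M.SignalStatistics P s p) (s₁ s₂ : Tx s) :
    crossMoment P (fun ω => M.sampled s s₁ ω p) (fun ω => M.sampled s s₂ ω p) =
      if s₁ = s₂ then (L : ℂ) • M.signalCov P s₁ else 0 := by
  have hsym_sens (r₁ r₂ : Tx s) (k : Fin K) (n : Fin N) :
      crossMoment P (fun ω => M.sampled s r₁ ω p) (fun ω => M.sampled s r₂ ω p)
        (Sum.inl k) (Sum.inr n) = 0 :=
    (eq_natCast_mul_of_inv_mul_sum_eq (hst.sym_sens r₁ r₂ k n)).trans (mul_zero _)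
  ext (k₁ | n₁) (k₂ | n₂)
  · refine (eq_natCast_mul_of_inv_mul_sum_eq (hst.sym_sym s₁ s₂ k₁ k₂)).trans ?_
    by_cases h : s₁ = s₂ <;> simp [h, signalCov, one_apply]
  · rw [hsym_sens]
    split_ifs <;> simp [signalCov]
  · rw [← conjTranspose_crossMoment, conjTranspose_apply, hsym_sens]
    split_ifs <;> simp [signalCov]
  · refine (eq_natCast_mul_of_inv_mul_sum_eq (hst.sens_sens s₁ s₂ n₁ n₂)).trans ?_
    by_cases h : s₁ = s₂ <;> simp [h, signalCov]

lemma SignalStatistics.crossMoment_delayed (hst : M.SignalStatistics P s p)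
    (hreg : M.RegularSignals P s p) (s₁ s₂ : Tx s) :
    crossMoment P (fun ω => M.delayed s s₁ ω p) (fun ω => M.delayed s s₂ ω p) =
      if s₁ = s₂ then (L : ℂ) • M.txCov P s₁ else 0 := by
  simp only [delayed_eq_precoder_mul_sampled]
  rw [crossMoment_mul_left _ (hreg.memLp_sampled s₁) (memLp_mul_apply _ (hreg.memLp_sampled s₂)),
    crossMoment_mul_right _ (hreg.memLp_sampled s₁) (hreg.memLp_sampled s₂),
    hst.crossMoment_sampled]
  split_ifs with h
  · rw [← h, Matrix.smul_mul, Matrix.mul_smul, ← Matrix.mul_assoc,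
      precoder_mul_signalCov_mul_conjTranspose]
  · rw [Matrix.zero_mul, Matrix.mul_zero]

lemma SignalStatistics.crossMoment_mul_delayed (hst : M.SignalStatistics P s p)
    (hreg : M.RegularSignals P s p) (A B : Tx s → Matrix (Fin N) (Fin N) ℂ) (s₁ s₂ : Tx s) :
    crossMoment P (fun ω => A s₁ * M.delayed s s₁ ω p) (fun ω => B s₂ * M.delayed s s₂ ω p) =
      if s₁ = s₂ then (L : ℂ) • (A s₁ * M.txCov P s₁ * (B s₁)ᴴ) else 0 := by
  rw [crossMoment_mul_left _ (hreg.memLp_delayed s₁) (memLp_mul_apply _ (hreg.memLp_delayed s₂)),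
    crossMoment_mul_right _ (hreg.memLp_delayed s₁) (hreg.memLp_delayed s₂),
    hst.crossMoment_delayed hreg]
  split_ifs with h
  · rw [← h, Matrix.smul_mul, Matrix.mul_smul, ← Matrix.mul_assoc]
  · rw [Matrix.zero_mul, Matrix.mul_zero]

end Covariance

section FisherBlocks

variable (hreg : M.RegularSignals P s (target ξ)) (hpos : ∀ r, target ξ ≠ M.pos r)
  (hconv : M.DelayConvention P s (target ξ)) (hst : M.SignalStatistics P s (target ξ))
include hreg hpos hconv

lemma DelayConvention.meanDeriv_ae_eq (i : Idx s) :
    (fun ω => M.meanDeriv s ξ ω i) =ᵐ[P] fun ω =>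
      vec (∑ s', M.coeffMatrix s ξ i s' * M.delayed s s' ω (target ξ)) := by
  filter_upwards [hreg.ae_smoothSignals, hconv] with ω hω hconvω
  have hdelayed (s' : Tx s) (i : Fin 2) : M.precoder s' * M.sampledDeriv s s' ω (target ξ) i =
      -(M.delayDeriv s s' (target ξ) i : ℂ) • M.delayed s s' ω (target ξ) := by
    ext n l
    rw [← (hω.hasLineDerivAt_delayed hpos s' i n l).lineDeriv]
    exact hconvω s' i n l
  have hecho (s' : Tx s) (i : Fin 2) : M.echoDeriv s s' ω (target ξ) i =
      vec (M.responseTilde s s' (target ξ) i * M.delayed s s' ω (target ξ)) := by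
    rw [echoDeriv, hdelayed, responseTilde, Matrix.sub_mul, Matrix.mul_smul, Matrix.smul_mul,
      neg_smul, ← sub_eq_add_neg]
  rw [meanDeriv, vec_sum]
  refine Finset.sum_congr rfl fun s' _ => ?_
  rcases i with i | r
  · rw [coeffMatrix_inl, Sum.elim_inl, hecho, gain_single_inl, zero_smul, add_zero, Matrix.smul_mul,
      vec_smul]
  · rw [coeffMatrix_inr, Sum.elim_inr, Pi.zero_apply, smul_zero, zero_add, Matrix.smul_mul,
      vec_smul, echo]

variable [SFinite P]
include hst

lemma SignalStatistics.fisher_apply (i j : Idx s) :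
    M.fisher P s ξ i j = M.snrFactor s *
      (∑ s' : Tx s, (M.coeffMatrix s ξ j s' * M.txCov P s' *
        (M.coeffMatrix s ξ i s')ᴴ).trace).re := by
  have hsummand (i : Idx s) (s' : Tx s) (n : Fin N) (l : Fin L) :
      MemLp (fun ω => (M.coeffMatrix s ξ i s' * M.delayed s s' ω (target ξ)) n l) 2 P :=
    memLp_mul_apply _ (hreg.memLp_delayed s') n l
  have hsum (i : Idx s) (n : Fin N) (l : Fin L) :
      MemLp (fun ω => (∑ s', M.coeffMatrix s ξ i s' * M.delayed s s' ω (target ξ)) n l) 2 P := by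
    simp only [Matrix.sum_apply]
    exact memLp_finsetSum _ fun s' _ => hsummand i s' n l
  have hmean (i : Idx s) := hconv.meanDeriv_ae_eq hreg hpos i
  have hcongr : ∫ ω, reInner (M.meanDeriv s ξ ω i) (M.meanDeriv s ξ ω j) ∂P = _ :=
    integral_congr_ae ((hmean i).comp₂ (fun u v => reInner u v) (hmean j))
  rw [hreg.fisher_apply hpos, hcongr, integral_reInner_vec (hsum i) (hsum j),
    crossMoment_sum_left _ (hsummand j) (hsum i)]
  simp only [crossMoment_sum_right _ (hsummand j _) (hsummand i),
    hst.crossMoment_mul_delayed hreg, Finset.sum_ite_eq,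
    Finset.mem_univ, if_true, trace_sum, trace_smul, ← Finset.smul_sum, snrFactor]
  rw [smul_eq_mul, ← Complex.ofReal_natCast, Complex.re_ofReal_mul]
  ring

lemma SignalStatistics.fisher_inl_inl (i j : Fin 2) :
    M.fisher P s ξ (Sum.inl i) (Sum.inl j) = M.Fpp P s ξ i j := by
  simp only [hst.fisher_apply hreg hpos hconv, coeffMatrix_inl, Fpp, Matrix.smul_apply, of_apply,
    smul_eq_mul, trace_sum, Matrix.smul_mul, Matrix.mul_smul, conjTranspose_smul, trace_smul]
  congr! 3 with s'
  rw [← mul_assoc, Complex.star_def, Complex.conj_mul', Complex.ofReal_pow]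

lemma SignalStatistics.fisher_inl_inr (i : Fin 2) (r : Tx s ⊕ Tx s) :
    M.fisher P s ξ (Sum.inl i) (Sum.inr r) = M.Fpa P s ξ i r := by
  simp only [hst.fisher_apply hreg hpos hconv, coeffMatrix_inl, coeffMatrix_inr, Matrix.smul_mul,
    Matrix.mul_smul, conjTranspose_smul, trace_smul, smul_eq_mul]
  rcases r with r | r
  · simp [gain_single_inr_inl, Fpa, Dmat]
  · simp [gain_single_inr_inr, Fpa, Dmat, mul_left_comm]

lemma SignalStatistics.fisher_inr_inr (r r' : Tx s ⊕ Tx s) :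
    M.fisher P s ξ (Sum.inr r) (Sum.inr r') = M.Faa P s ξ r r' := by
  have him (r : Tx s) := im_trace_response_mul_txCov (M := M) (P := P) (s := s) r (target ξ)
  simp only [hst.fisher_apply hreg hpos hconv, coeffMatrix_inr, Matrix.smul_mul,
    Matrix.mul_smul, conjTranspose_smul, trace_smul, smul_eq_mul]
  rcases r with r | r <;> rcases r' with r' | r' <;> by_cases h : r = r' <;>
    simp [gain_single_inr_inl, gain_single_inr_inr, Faa, Emat, h, him, Ne.symm]

lemma SignalStatistics.fisher_eq_fromBlocks :
    M.fisher P s ξ = fromBlocks (M.Fpp P s ξ) (M.Fpa P s ξ) (M.Fpa P s ξ)ᵀ (M.Faa P s ξ) := by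
  have hinl_inr := hst.fisher_inl_inr hreg hpos hconv
  ext (i | r) (j | r')
  · exact hst.fisher_inl_inl hreg hpos hconv i j
  · exact hinl_inr i r'
  · exact ((isSymm_secondMoment (M.law P s ξ) (M.score s ξ)).apply _ _).trans (hinl_inr j r)
  · exact hst.fisher_inr_inr hreg hpos hconv r r'

end FisherBlocks

end IsacNetwork

theorem proposition1 {S K N L : ℕ} {Ω : Type*} [MeasurableSpace Ω]
    (P : Measure Ω) [IsProbabilityMeasure P]
    (M : IsacNetwork S K N L Ω) (s : Fin S) (ξ : IsacNetwork.Param s)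
    (hpos : ∀ s', IsacNetwork.target ξ ≠ M.pos s')
    (hreg : M.RegularSignals P s (IsacNetwork.target ξ)) :
    -- the statistical model is regular at `ξ`
    (IsProbabilityMeasure (M.law P s ξ) ∧
      (∀ᵐ z ∂(M.law P s ξ), DifferentiableAt ℝ (M.logLik s z) ξ) ∧
      (∀ i, MemLp (M.score s ξ i) 2 (M.law P s ξ))) ∧
    -- the bound as a Schur complement, and its validity for unbiased estimators
    (IsUnit (M.fisher P s ξ).det →
      IsUnit (M.fisher P s ξ).toBlocks₂₂.det ∧
      IsUnit ((M.fisher P s ξ).toBlocks₁₁ - (M.fisher P s ξ).toBlocks₁₂ *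
        (M.fisher P s ξ).toBlocks₂₂⁻¹ * (M.fisher P s ξ).toBlocks₁₂ᵀ).det ∧
      M.crlb P s ξ = Matrix.trace ((M.fisher P s ξ).toBlocks₁₁ -
        (M.fisher P s ξ).toBlocks₁₂ * (M.fisher P s ξ).toBlocks₂₂⁻¹ *
          (M.fisher P s ξ).toBlocks₁₂ᵀ)⁻¹ ∧
      ∀ T : Ω × IsacNetwork.Obs N L → Plane, M.IsUnbiased P s ξ T →
        ENNReal.ofReal (M.crlb P s ξ) ≤
          ∫⁻ z, ‖T z - IsacNetwork.target ξ‖ₑ ^ 2 ∂(M.law P s ξ)) ∧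
    -- the explicit blocks of the Fisher information matrix
    (M.DelayConvention P s (IsacNetwork.target ξ) →
      M.SignalStatistics P s (IsacNetwork.target ξ) →
      M.fisher P s ξ = Matrix.fromBlocks (M.Fpp P s ξ) (M.Fpa P s ξ)
        (M.Fpa P s ξ)ᵀ (M.Faa P s ξ) ∧
      (IsUnit (M.fisher P s ξ).det →
        M.crlb P s ξ = Matrix.trace
          (M.Fpp P s ξ - M.Fpa P s ξ * (M.Faa P s ξ)⁻¹ * (M.Fpa P s ξ)ᵀ)⁻¹)) := by
  have hsymm : (M.fisher P s ξ).IsSymm := isSymm_secondMoment (M.law P s ξ) (M.score s ξ)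
  have hpsd : (M.fisher P s ξ).PosSemidef := posSemidef_secondMoment (hreg.memLp_score hpos)
  have hcrlb (hdet : IsUnit (M.fisher P s ξ).det) : M.crlb P s ξ =
      Matrix.trace ((M.fisher P s ξ).toBlocks₁₁ - (M.fisher P s ξ).toBlocks₁₂ *
        (M.fisher P s ξ).toBlocks₂₂⁻¹ * (M.fisher P s ξ).toBlocks₁₂ᵀ)⁻¹ := by
    rw [IsacNetwork.crlb, toBlocks₁₁_inv hdet (isUnit_det_toBlocks₂₂ hpsd hdet),
      toBlocks₂₁_eq_transpose_toBlocks₁₂ hsymm]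
  refine ⟨⟨hreg.isProbabilityMeasure_law, ?_, hreg.memLp_score hpos⟩,
    fun hdet => ⟨isUnit_det_toBlocks₂₂ hpsd hdet, ?_, hcrlb hdet,
      fun T hT => hT.ofReal_crlb_le_lintegral hreg hpos hdet⟩, fun hconv hst => ?_⟩
  · exact hreg.ae_law_smoothSignals.mono fun z hz => IsacNetwork.differentiableAt_logLik hz hpos
  · rw [← toBlocks₂₁_eq_transpose_toBlocks₁₂ hsymm]
    exact isUnit_det_schur hdet (isUnit_det_toBlocks₂₂ hpsd hdet)
  · have hblocks := hst.fisher_eq_fromBlocks hreg hpos hconv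
    refine ⟨hblocks, fun hdet => ?_⟩
    rw [hcrlb hdet, hblocks, Matrix.toBlocks_fromBlocks₁₁, Matrix.toBlocks_fromBlocks₁₂,
      Matrix.toBlocks_fromBlocks₂₂]
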